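/- **Theorem (instability for rectangular lattices).** Let $\gamma>0$, $\tau=\frac{i\pi}{\gamma^2}$, $R_\alpha u(z)=e^{\frac12(\alpha\bar z-\bar\alpha z)}u(z+\alpha)$ and $$\Pi u(z)=\tfrac1\pi e^{-\frac{|z|^2}{2}}\int_{\mathbb C}e^{\bar w z-\frac{|w|^2}{2}}u(w)\,dL(w).$$ Let $\mathcal F_\gamma$ be the space of functions $u(z)=e^{-|z|^2/2}f(z)$ with $f$ entire, $|u|$ of at most polynomial growth and $R_\gamma u=u$; let $S_\gamma=\{0\le \operatorname{Re}z\le\gamma\}$, and $$\psi_0(z)=\Big(\tfrac{2}{\pi\gamma^2}\Big)^{1/4}e^{\frac{z^2}{2}-\frac{|z|^2}{2}},\qquad \psi_n=R_{in\pi/\gamma}\psi_0\quad(n\in\mathbb Z),$$ $$\Phi_0(z)=e^{\frac{z^2}{2}-\frac{i\pi}{\gamma}z-\frac{|z|^2}{2}}\,\Theta_\tau\Big(\tfrac z\gamma-\tfrac{\tau-1}{2}\Big),\qquad \Theta_\tau(z)=-i\sum_{n\in\mathbb Z}(-1)^ne^{i\pi\tau(n+\frac12)^2}e^{i(2n+1)\pi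 z}.$$ Put $$\ell(\xi)=1+2\sum_{k\ge1}e^{-\pi^2k^2/\gamma^2}\cos(2\pi k\xi),\qquad C_M=\tfrac1{\sqrt2}e^{\frac{\pi^2}{2\gamma^2}},\qquad \lambda=C_M\Big(\sum_{q\in\mathbb Z}e^{-\pi^2q^2/\gamma^2}\Big)^2.$$ Then $\Pi(|\Phi_0|^2\Phi_0)=\lambda\Phi_0$, so that $e^{-i\lambda t}\Phi_0$ is a stationary wave of $i\partial_tu=\Pi(|u|^2u)$. Consider the linearized equation $$i\partial_t v+\lambda v=\Pi\big[2|\Phi_0|^2v+\Phi_0^2\bar v\big],\qquad v(t)\in L^2(S_\gamma)\cap\mathcal F_\gamma,\tag{$*$}$$ where $\partial_t$ is taken in $L^2(S_\gamma)$. 1. Every $u\in L^2(S_\gamma)\cap\mathcal F_\gamma$ has a unique expansion $u=\sum_nc_n\psi_n$ in $L^2(S_\gamma)$, and $\sum_nc_ne^{-2\pi in\xi}$ converges in $L^2([0,1])$. If $v:\mathbb R\to L^2(S_\gamma)\cap\mathcal F_\gamma$, $v(t)=\sum_nc_n(t)\psi_n$ and $f(t,\xi)=\sum_nc_n(t)e^{-2\pi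 in\xi}$ ($1$-periodic in $\xi$), then at each time $t$ equation $(*)$ holds if and only if, with $\partial_t$ taken in $L^2([0,1])$, $$i\partial_t\begin{pmatrix}f(t,\xi)\\ \overline{f}(t,-\xi)\end{pmatrix}=A_{\rm rect}(\xi)\begin{pmatrix}f(t,\xi)\\ \overline{f}(t,-\xi)\end{pmatrix},\qquad A_{\rm rect}=\begin{pmatrix}a&b\\-b&-a\end{pmatrix},$$ where $a(\xi)=C_M\,\ell(0)(2\ell(\xi)-\ell(0))$ and $b(\xi)=C_M\,\ell(\xi)^2$. 2. Let $D=b^2-a^2=\det A_{\rm rect}$ and $\mu=\sqrt{-D}$, with $\operatorname{Im}\mu\ge0$ if $D\ge0$. For every $\xi\in\mathbb R$ the eigenvalues of $A_{\rm rect}(\xi)$, with multiplicity, are $\pm\mu(\xi)$. If $\mu(\xi)\ne0$, then $$A_{\rm rect}(\xi)=P(\xi)\begin{pmatrix}\mu(\xi)&0\\0&-\mu(\xi)\end{pmatrix}P(\xi)^{-1},\qquad P=\begin{pmatrix}b&b\\ \mu-a&-\mu-a\end{pmatrix},$$ with $P(\xi)$ invertible. Moreover $\mu(\xi)=0$ if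 and only if $\xi\in\mathbb Z$ or $\ell(\xi)=(\sqrt2-1)\ell(0)$, which happens for only finitely many $\xi\in[0,1]$. 3. There is $\delta>0$ such that $\mu(\xi)\in i\mathbb R\setminus\{0\}$ for $0<|\xi|<\delta$. 4. If $\tau=i$ (square lattice), then $\mu(\xi)\in i\mathbb R\setminus\{0\}$ for every $\xi\in\mathbb R\setminus\mathbb Z$. 5. The rectangular lattice is exponentially unstable in $L^2(S_\gamma)\cap\mathcal F_\gamma$: there are $\sigma>0$, $C>0$ and a solution $v$ of $(*)$, defined for all $t\in\mathbb R$, with $v(0)=\psi_0$ and $\|v(t)\|_{L^2(S_\gamma)}\ge Ce^{\sigma t}$ for all $t\ge0$. -/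

import Mathlib

open MeasureTheory Filter Topology Set
open scoped ComplexConjugate

noncomputable section

namespace LLL

/-! ### Magnetic translations, the Bargmann projector, simply periodic functions -/

/-- Magnetic translation `R_α u(z) = exp((α z̄ - ᾱ z)/2) u(z + α)`. -/
def magTrans (α : ℂ) (u : ℂ → ℂ) (z : ℂ) : ℂ :=
  Complex.exp ((α * conj z - conj α * z) / 2) * u (z + α)

/-- The lowest Landau level projector, through its integral kernel on the whole plane. -/
def bargmannProj (u : ℂ → ℂ) (z : ℂ) : ℂ :=
  (1 / (Real.pi : ℂ)) * Complex.exp (-((‖z‖ ^ 2 : ℝ) : ℂ) / 2) *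
    ∫ w : ℂ, Complex.exp (conj w * z - ((‖w‖ ^ 2 : ℝ) : ℂ) / 2) * u w

/-- `u(z) = exp(-|z|²/2) f(z)` with `f` entire and `u` of at most polynomial growth. -/
def InFockTilde (u : ℂ → ℂ) : Prop :=
  (∃ f : ℂ → ℂ, Differentiable ℂ f ∧
    ∀ z, u z = Complex.exp (-((‖z‖ ^ 2 : ℝ) : ℂ) / 2) * f z) ∧
  ∃ (M : ℕ) (C : ℝ), ∀ z, ‖u z‖ ≤ C * Real.sqrt (1 + ‖z‖ ^ 2) ^ M

/-- The space `F_γ` of simply periodic functions. -/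
def InFgamma (γ : ℝ) (u : ℂ → ℂ) : Prop :=
  InFockTilde u ∧ magTrans (γ : ℂ) u = u

/-- The vertical strip of width `γ`, a fundamental domain for `z ↦ z + γ`. -/
def strip (γ : ℝ) : Set ℂ := {z | 0 ≤ z.re ∧ z.re ≤ γ}

/-- Lebesgue measure on the strip. -/
def stripMeasure (γ : ℝ) : Measure ℂ := volume.restrict (strip γ)

/-- Membership in `L²(S_γ) ∩ F_γ`. -/
def InX (γ : ℝ) (u : ℂ → ℂ) : Prop :=
  InFgamma γ u ∧ MemLp u 2 (stripMeasure γ)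

/-! ### The Hilbert basis `ψ_n`, and the rectangular lattice `Φ₀` -/

/-- `ψ₀(z) = (2/(πγ²))^{1/4} exp(z²/2 - |z|²/2)`. -/
def psiZero (γ : ℝ) (z : ℂ) : ℂ :=
  (((2 / (Real.pi * γ ^ 2)) ^ (1 / 4 : ℝ) : ℝ) : ℂ) *
    Complex.exp (z ^ 2 / 2 - ((‖z‖ ^ 2 : ℝ) : ℂ) / 2)

/-- `ψ_n = R_{inπ/γ} ψ₀`. -/
def psi (γ : ℝ) (n : ℤ) : ℂ → ℂ :=
  magTrans (Complex.I * n * Real.pi / γ) (psiZero γ)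

/-- The Jacobi Theta function `Θ_τ`. -/
def Theta (τ z : ℂ) : ℂ :=
  -Complex.I * ∑' n : ℤ, (-1 : ℂ) ^ n *
    Complex.exp (Complex.I * Real.pi * τ * (n + 1 / 2) ^ 2) *
    Complex.exp (Complex.I * (2 * n + 1) * Real.pi * z)

/-- The modulus of the rectangular lattice, `τ = iπ/γ²`. -/
def tau (γ : ℝ) : ℂ := Complex.I * Real.pi / (γ : ℂ) ^ 2

/-- The stationary profile `Φ₀` of the rectangular lattice `γ(ℤ + τℤ)`. -/
def Phi0 (γ : ℝ) (z : ℂ) : ℂ :=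
  Complex.exp (z ^ 2 / 2 - Complex.I * Real.pi / γ * z - ((‖z‖ ^ 2 : ℝ) : ℂ) / 2) *
    Theta (tau γ) (z / γ - (tau γ - 1) / 2)

/-- The frequency of the stationary wave `exp(-iλt) Φ₀`. -/
def lam (γ : ℝ) : ℝ :=
  1 / Real.sqrt 2 * Real.exp (Real.pi ^ 2 / (2 * γ ^ 2)) *
    (∑' q : ℤ, Real.exp (-(Real.pi ^ 2 * (q : ℝ) ^ 2 / γ ^ 2))) ^ 2

/-! ### The linearized equation -/

/-- `u : ℝ → (X → ℂ)` has time derivative `w` at time `t`, as a limit in `L²(μ)`. -/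
def HasL2Deriv {X : Type*} [MeasurableSpace X] (μ : Measure X)
    (u : ℝ → X → ℂ) (w : X → ℂ) (t : ℝ) : Prop :=
  Tendsto (fun h : ℝ => eLpNorm (fun x => (h : ℂ)⁻¹ * (u (t + h) x - u t x) - w x) 2 μ)
    (𝓝[≠] 0) (𝓝 0)

/-- `Π(2|Φ₀|² v + Φ₀² v̄)`. -/
def linTerm (γ : ℝ) (v : ℂ → ℂ) : ℂ → ℂ :=
  bargmannProj fun z =>
    2 * ((‖Phi0 γ z‖ ^ 2 : ℝ) : ℂ) * v z + Phi0 γ z ^ 2 * conj (v z)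

/-- At time `t`, `i ∂ₜ v + λ v = Π(2|Φ₀|² v + Φ₀² v̄)`, the derivative being taken in `L²(S_γ)`. -/
def LinEqAt (γ : ℝ) (v : ℝ → ℂ → ℂ) (t : ℝ) : Prop :=
  ∃ w : ℂ → ℂ, HasL2Deriv (stripMeasure γ) v w t ∧
    ∀ z, Complex.I * w z + (lam γ : ℂ) * v t z = linTerm γ (v t) z

/-- Global solutions of the linearized equation in `L²(S_γ) ∩ F_γ`. -/
def IsLinSolution (γ : ℝ) (v : ℝ → ℂ → ℂ) : Prop :=
  (∀ t, InX γ (v t)) ∧ ∀ t, LinEqAt γ v t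

/-- `u = ∑ c_n ψ_n`, with (unconditional) convergence in `L²(S_γ)`. -/
def HasPsiExpansion (γ : ℝ) (u : ℂ → ℂ) (c : ℤ → ℂ) : Prop :=
  Tendsto (fun s : Finset ℤ =>
    eLpNorm (fun z => u z - ∑ n ∈ s, c n * psi γ n z) 2 (stripMeasure γ)) atTop (𝓝 0)

/-- Lebesgue measure on `[0,1]`. -/
def unitMeasure : Measure ℝ := volume.restrict (Icc (0 : ℝ) 1)

/-- `f` is the (1-periodic) discrete Fourier transform `f(ξ) = ∑ c_n exp(-2πinξ)` of `c`,
with (unconditional) convergence in `L²([0,1])`. -/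
def HasDFT (f : ℝ → ℂ) (c : ℤ → ℂ) : Prop :=
  Function.Periodic f 1 ∧ MemLp f 2 unitMeasure ∧
  Tendsto (fun s : Finset ℤ =>
    eLpNorm (fun ξ => f ξ - ∑ n ∈ s, c n * Complex.exp (-2 * Real.pi * Complex.I * n * ξ))
      2 unitMeasure) atTop (𝓝 0)

/-! ### The symbol and its diagonalization -/

/-- `ℓ(ξ) = 1 + 2 ∑_{k ≥ 1} exp(-π²k²/γ²) cos(2πkξ)`. -/
def ell (γ ξ : ℝ) : ℝ :=
  1 + 2 * ∑' k : ℕ, Real.exp (-(Real.pi ^ 2 * ((k : ℝ) + 1) ^ 2 / γ ^ 2)) *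
    Real.cos (2 * Real.pi * ((k : ℝ) + 1) * ξ)

/-- `C_M = 2^{-1/2} exp(π²/(2γ²))`. -/
def CM (γ : ℝ) : ℝ := 1 / Real.sqrt 2 * Real.exp (Real.pi ^ 2 / (2 * γ ^ 2))

/-- `a(ξ) = C_M ℓ(0) (2ℓ(ξ) - ℓ(0))`. -/
def aSym (γ ξ : ℝ) : ℝ := CM γ * (ell γ 0 * (2 * ell γ ξ - ell γ 0))

/-- `b(ξ) = C_M ℓ(ξ)²`. -/
def bSym (γ ξ : ℝ) : ℝ := CM γ * ell γ ξ ^ 2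

/-- The matrix `A_rect(ξ)`. -/
def Arect (γ ξ : ℝ) : Matrix (Fin 2) (Fin 2) ℂ :=
  !![(aSym γ ξ : ℂ), (bSym γ ξ : ℂ); -(bSym γ ξ : ℂ), -(aSym γ ξ : ℂ)]

/-- `D(ξ) = det A_rect(ξ) = b(ξ)² - a(ξ)²`. -/
def Dsym (γ ξ : ℝ) : ℝ := bSym γ ξ ^ 2 - aSym γ ξ ^ 2

/-- `μ(ξ) = √(-D(ξ))`, with nonnegative imaginary part when `D(ξ) ≥ 0`: one of the two
square roots below is zero. -/
def mu (γ ξ : ℝ) : ℂ :=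
  (Real.sqrt (-Dsym γ ξ) : ℂ) + Complex.I * (Real.sqrt (Dsym γ ξ) : ℂ)

/-- The matrix whose columns are the eigenvectors `(b, ±μ - a)`. -/
def Pmat (γ ξ : ℝ) : Matrix (Fin 2) (Fin 2) ℂ :=
  !![(bSym γ ξ : ℂ), (bSym γ ξ : ℂ); mu γ ξ - (aSym γ ξ : ℂ), -mu γ ξ - (aSym γ ξ : ℂ)]

/-- The vector `(f(ξ), conj f(-ξ))`. -/
def pairVec (f : ℝ → ℂ) (ξ : ℝ) : Fin 2 → ℂ := ![f ξ, conj (f (-ξ))]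

/-- At time `t`, `i ∂ₜ (f(ξ), conj f(-ξ)) = A_rect(ξ) (f(ξ), conj f(-ξ))`, the derivative of each
component being taken in `L²([0,1])`. -/
def FourierEqAt (γ : ℝ) (f : ℝ → ℝ → ℂ) (t : ℝ) : Prop :=
  ∃ g : ℝ → Fin 2 → ℂ,
    (∀ j, HasL2Deriv unitMeasure (fun s ξ => pairVec (f s) ξ j) (fun ξ => g ξ j) t) ∧
    ∀ ξ, Complex.I • g ξ = (Arect γ ξ).mulVec (pairVec (f t) ξ)

end LLL

end

/-!
Write `z = x + iy` and `β_n = nπ/γ`. The normalized modes factor as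

  `ψ_n(z) = N exp(ixy) exp(-(y + β_n)²) exp(2iβ_n x)`,

so that, once the magnetic phase `exp(ixy)` is removed, an element of `L²(S_γ) ∩ F_γ` is on each
horizontal line a Fourier series of period `γ` in `x`. Cauchy's theorem on a period rectangle shows
that the coefficients depend on `y` only through the Gaussian above (`exists_lineCoef`). Parseval's
identity on each line, integrated in `y`, then identifies `L²(S_γ) ∩ F_γ` isometrically with
`ℓ²(ℤ)` (`eLpNorm_sq_synth`, `exists_eq_synth`); Parseval's identity on `[0,1]` does the same for the
discrete Fourier transforms (`hasDFT_iff`).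

The projector acts on products of modes by two Gaussian integrals (`bargmannProj_cubic`):

  `Π(ψ_m conj(ψ_k) ψ_n) = (N²/√2) θ_{m-k} θ_{n-k} ψ_{m+n-k}`,  `θ_q = exp(-π²q²/γ²)`.

Since `Φ₀` is a multiple of `∑ ψ_n` (`Phi0_eq_synth`), summing this identity gives the stationary
wave, and shows that the linearized operator acts on the amplitudes `c` of `v` by one convolution
of `c` and two convolutions of `conj c` with `θ` (`linTerm_synth`). As `ℓ` is the Fourier series with
coefficients `θ`, these become multiplication by `ℓ` and `ℓ²`, which is the symbol `A_rect`; the time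
derivatives agree because both are `ℓ²` derivatives of the amplitudes (`hasL2Deriv_strip_iff`).

For the spectrum, `b - a = C_M (ℓ - ℓ(0))²` and `b + a = C_M ((ℓ + ℓ(0))² - 2ℓ(0)²)`. The first factor
of `D = (b - a)(b + a)` vanishes exactly at the integers, and the second at `ℓ = (√2 - 1)ℓ(0)`,
because `ℓ > 0` by Poisson summation (`ell_pos`); the latter happens finitely often by analyticity.
Near `ξ = 0` both factors are positive off `0`, so the pointwise system is hyperbolic there. The
solution with Fourier datum `1`, which is `ψ₀`, is even in `ξ` and its modulus grows exponentially,
uniformly on a small interval near `0` (`exp_growth`, `exists_growth`).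
-/

noncomputable section

namespace LLL

/-! ### The symbol `ℓ` as a theta function -/

/-- The Gaussian weights `θ_n = exp(-π²n²/γ²)`, the Fourier coefficients of `ℓ`. -/
def theta (γ : ℝ) (n : ℤ) : ℝ := Real.exp (-(Real.pi ^ 2 * (n : ℝ) ^ 2 / γ ^ 2))

lemma theta_pos (γ : ℝ) (n : ℤ) : 0 < theta γ n := Real.exp_pos _

lemma theta_neg (γ : ℝ) (n : ℤ) : theta γ (-n) = theta γ n := by
  simp [theta]

lemma tau_im {γ : ℝ} (hγ : 0 < γ) : 0 < (tau γ).im := by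
  have : tau γ = ((Real.pi / γ ^ 2 : ℝ) : ℂ) * Complex.I := by
    simp only [tau]; push_cast; ring
  rw [this]
  simp only [Complex.mul_im, Complex.ofReal_re, Complex.I_im, Complex.ofReal_im, Complex.I_re,
    mul_one, mul_zero, add_zero]
  positivity

lemma jacobiTheta₂_term_tau {γ : ℝ} (n : ℤ) (z : ℂ) :
    jacobiTheta₂_term n z (tau γ) = theta γ n * Complex.exp (2 * Real.pi * Complex.I * n * z) := by
  simp only [jacobiTheta₂_term, theta, tau]
  push_cast
  rw [← Complex.exp_add]
  congr 1
  ring_nf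
  simp only [Complex.I_sq]
  ring

lemma summable_theta {γ : ℝ} (hγ : 0 < γ) : Summable (theta γ) := by
  have h := (summable_jacobiTheta₂_term_iff 0 (tau γ)).2 (tau_im hγ)
  have := h.norm
  refine this.congr fun n => ?_
  rw [jacobiTheta₂_term_tau]
  simp [abs_of_pos (theta_pos γ n)]

lemma summable_theta_mul_cos {γ : ℝ} (hγ : 0 < γ) (ξ : ℝ) :
    Summable fun n : ℤ => theta γ n * Real.cos (2 * Real.pi * n * ξ) := by
  refine Summable.of_norm_bounded (summable_theta hγ) fun n => ?_
  rw [norm_mul, Real.norm_of_nonneg (theta_pos γ n).le]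
  exact mul_le_of_le_one_right (theta_pos γ n).le (Real.abs_cos_le_one _)

lemma hasSum_theta_mul_cos {γ : ℝ} (hγ : 0 < γ) (ξ : ℝ) :
    HasSum (fun n : ℤ => theta γ n * Real.cos (2 * Real.pi * n * ξ)) (ell γ ξ) := by
  have hs := summable_theta_mul_cos hγ ξ
  have h1 : Summable fun n : ℕ => theta γ (n + 1) * Real.cos (2 * Real.pi * ((n : ℝ) + 1) * ξ) := by
    have := hs.comp_injective (i := fun n : ℕ => ((n : ℤ) + 1)) (fun a b h => by simpa using h)
    refine this.congr fun n => ?_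
    simp
  have e2 : ∀ n : ℕ, theta γ (-((n : ℤ) + 1)) *
      Real.cos (2 * Real.pi * ((-((n : ℤ) + 1) : ℤ) : ℝ) * ξ)
      = theta γ (n + 1) * Real.cos (2 * Real.pi * ((n : ℝ) + 1) * ξ) := by
    intro n
    rw [theta_neg, ← Real.cos_neg]
    congr 2
    push_cast
    ring
  rw [hs.hasSum_iff, tsum_of_add_one_of_neg_add_one]
  · simp only [e2]
    simp only [ell, theta]
    push_cast
    simp
    ring
  · simpa using h1
  · refine h1.congr fun n => ?_
    rw [e2]

lemma ell_eq_jacobiTheta₂ {γ : ℝ} (hγ : 0 < γ) (ξ : ℝ) :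
    (ell γ ξ : ℂ) = jacobiTheta₂ ξ (tau γ) := by
  have h := hasSum_jacobiTheta₂_term (ξ : ℂ) (tau_im hγ)
  have h' := (Equiv.neg ℤ).hasSum_iff.2 h
  have h2 := (h.add h').mul_left (1 / 2 : ℂ)
  have h3 := Complex.hasSum_ofReal.2 (hasSum_theta_mul_cos hγ ξ)
  have e : (fun n : ℤ => (1 / 2 : ℂ) * (jacobiTheta₂_term n ξ (tau γ) +
      ((jacobiTheta₂_term · ξ (tau γ)) ∘ Equiv.neg ℤ) n)) =
      fun n : ℤ => ((theta γ n * Real.cos (2 * Real.pi * n * ξ) : ℝ) : ℂ) := by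
    funext n
    simp only [Function.comp_apply, Equiv.neg_apply, jacobiTheta₂_term_tau, theta_neg]
    push_cast
    rw [Complex.cos]
    ring_nf
  rw [e] at h2
  rw [h3.unique h2]
  ring

lemma hasSum_ell {γ : ℝ} (hγ : 0 < γ) (ξ : ℝ) :
    HasSum (fun n : ℤ => (theta γ n : ℂ) * Complex.exp (2 * Real.pi * Complex.I * n * ξ))
      (ell γ ξ) := by
  have h := hasSum_jacobiTheta₂_term (ξ : ℂ) (tau_im hγ)
  rw [← ell_eq_jacobiTheta₂ hγ] at h
  simpa only [jacobiTheta₂_term_tau] using h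

lemma hasSum_theta {γ : ℝ} (hγ : 0 < γ) : HasSum (theta γ) (ell γ 0) := by
  simpa using hasSum_theta_mul_cos hγ 0

lemma ell_neg (γ ξ : ℝ) : ell γ (-ξ) = ell γ ξ := by
  simp [ell]

lemma ell_add_one (γ ξ : ℝ) : ell γ (ξ + 1) = ell γ ξ := by
  simp only [ell]
  congr 3 with k
  congr 1
  refine Eq.trans ?_ (Real.cos_add_nat_mul_two_pi _ (k + 1))
  congr 1
  push_cast
  ring

lemma ell_periodic (γ : ℝ) : Function.Periodic (ell γ) 1 := ell_add_one γ

lemma ell_le {γ : ℝ} (hγ : 0 < γ) (ξ : ℝ) : ell γ ξ ≤ ell γ 0 :=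
  hasSum_le (fun n => mul_le_of_le_one_right (theta_pos γ n).le (Real.cos_le_one _))
    (hasSum_theta_mul_cos hγ ξ) (hasSum_theta hγ)

lemma ell_eq_ell_zero_iff {γ : ℝ} (hγ : 0 < γ) (ξ : ℝ) :
    ell γ ξ = ell γ 0 ↔ ∃ k : ℤ, ξ = k := by
  constructor
  · intro h
    have h1 := (hasSum_theta hγ).sub (hasSum_theta_mul_cos hγ ξ)
    rw [h, sub_self] at h1
    have h2 := (hasSum_zero_iff_of_nonneg (fun n => sub_nonneg.2
      (mul_le_of_le_one_right (theta_pos γ n).le (Real.cos_le_one _)))).1 h1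
    have h3 := congrFun h2 1
    simp only [Int.cast_one, mul_one, Pi.zero_apply] at h3
    have h4 : Real.cos (2 * Real.pi * ξ) = 1 := by
      have := (theta_pos γ 1).ne'
      have h5 : theta γ 1 * (1 - Real.cos (2 * Real.pi * ξ)) = 0 := by linarith
      rcases mul_eq_zero.1 h5 with h6 | h6
      · exact absurd h6 this
      · linarith
    obtain ⟨k, hk⟩ := (Real.cos_eq_one_iff _).1 h4
    refine ⟨k, ?_⟩
    have := Real.pi_pos
    have h7 : (2 * Real.pi) * (ξ - k) = 0 := by linarith
    rcases mul_eq_zero.1 h7 with h8 | h8 <;> linarith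
  · rintro ⟨k, rfl⟩
    simpa using (ell_periodic γ).int_mul_eq k

lemma ell_zero_pos {γ : ℝ} (hγ : 0 < γ) : 0 < ell γ 0 := by
  rw [← (hasSum_theta hγ).tsum_eq]
  exact (summable_theta hγ).tsum_pos (fun n => (theta_pos γ n).le) 0 (theta_pos γ 0)

/-- `ℓ` is strictly positive: by Poisson summation it is a periodized Gaussian. -/
lemma ell_pos {γ : ℝ} (hγ : 0 < γ) (ξ : ℝ) : 0 < ell γ ξ := by
  have hπ := Real.pi_pos
  set a : ℝ := Real.pi / γ ^ 2 with ha
  have ha0 : 0 < a := by positivity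
  have h := Complex.tsum_exp_neg_quadratic (a := (a : ℂ)) (by simpa using ha0) (Complex.I * ξ)
  have hL : (∑' n : ℤ, Complex.exp (-Real.pi * (a : ℂ) * n ^ 2 +
      2 * Real.pi * (Complex.I * ξ) * n)) = ell γ ξ := by
    rw [← (hasSum_ell hγ ξ).tsum_eq]
    refine tsum_congr fun n => ?_
    rw [theta, Complex.ofReal_exp, ← Complex.exp_add]
    congr 1
    rw [ha]
    push_cast
    ring
  have hterm : ∀ n : ℤ, Complex.exp (-Real.pi / (a : ℂ) * (n + Complex.I * (Complex.I * ξ)) ^ 2)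
      = ((Real.exp (-γ ^ 2 * (n - ξ) ^ 2) : ℝ) : ℂ) := by
    intro n
    rw [Complex.ofReal_exp, ← mul_assoc, Complex.I_mul_I, ha]
    congr 1
    have : (Real.pi : ℂ) ≠ 0 := by exact_mod_cast hπ.ne'
    have : (γ : ℂ) ≠ 0 := by exact_mod_cast hγ.ne'
    push_cast
    field_simp
    ring
  have hsum : Summable fun n : ℤ => Real.exp (-γ ^ 2 * (n - ξ) ^ 2) := by
    have h0 : 0 < (Complex.I * (γ : ℂ) ^ 2 / Real.pi).im := by
      have : Complex.I * (γ : ℂ) ^ 2 / Real.pi = ((γ ^ 2 / Real.pi : ℝ) : ℂ) * Complex.I := by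
        push_cast; ring
      rw [this]
      simp only [Complex.mul_im, Complex.ofReal_re, Complex.I_im, Complex.ofReal_im, Complex.I_re,
        mul_one, mul_zero, add_zero]
      positivity
    have h1 := ((summable_jacobiTheta₂_term_iff (-Complex.I * γ ^ 2 * ξ / Real.pi) _).2 h0).norm
    have h2 := h1.mul_left (Real.exp (-γ ^ 2 * ξ ^ 2))
    refine h2.congr fun n => ?_
    have : jacobiTheta₂_term n (-Complex.I * γ ^ 2 * ξ / Real.pi) (Complex.I * (γ : ℂ) ^ 2 / Real.pi)
        = ((Real.exp (2 * γ ^ 2 * ξ * n - γ ^ 2 * n ^ 2) : ℝ) : ℂ) := by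
      rw [jacobiTheta₂_term, Complex.ofReal_exp]
      congr 1
      have : (Real.pi : ℂ) ≠ 0 := by exact_mod_cast hπ.ne'
      push_cast
      field_simp
      ring_nf
      simp only [Complex.I_sq]
      ring
    rw [this, Complex.norm_real, Real.norm_of_nonneg (Real.exp_pos _).le, ← Real.exp_add]
    congr 1
    ring
  rw [hL] at h
  simp only [hterm] at h
  rw [← Complex.ofReal_tsum] at h
  have hc : (1 : ℂ) / (a : ℂ) ^ (1 / 2 : ℂ) = ((1 / a ^ (1 / 2 : ℝ) : ℝ) : ℂ) := by
    rw [Complex.ofReal_div 1, Complex.ofReal_cpow ha0.le, Complex.ofReal_one]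
    congr 2
    norm_num
  rw [hc, ← Complex.ofReal_mul, Complex.ofReal_inj] at h
  rw [h]
  refine mul_pos (by positivity) ?_
  exact hsum.tsum_pos (fun n => (Real.exp_pos _).le) 0 (Real.exp_pos _)

lemma analyticAt_ell {γ : ℝ} (hγ : 0 < γ) (ξ : ℝ) : AnalyticAt ℝ (ell γ) ξ := by
  have hd : Differentiable ℂ fun z => jacobiTheta₂ z (tau γ) := fun z =>
    differentiableAt_jacobiTheta₂_fst z (tau_im hγ)
  have h1 : AnalyticAt ℝ (fun z => jacobiTheta₂ z (tau γ)) (ξ : ℂ) :=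
    (hd.analyticAt (ξ : ℂ)).restrictScalars
  have h2 : AnalyticAt ℝ (fun x : ℝ => (x : ℂ)) ξ := Complex.ofRealCLM.analyticAt ξ
  have h3 : AnalyticAt ℝ (fun x : ℝ => jacobiTheta₂ (x : ℂ) (tau γ)) ξ :=
    h1.fun_comp (f := fun x : ℝ => (x : ℂ)) h2
  have h4 : AnalyticAt ℝ (fun x : ℝ => (jacobiTheta₂ (x : ℂ) (tau γ)).re) ξ :=
    (Complex.reCLM.analyticAt _).fun_comp h3
  refine h4.congr (Eventually.of_forall fun x => ?_)
  simp only [← ell_eq_jacobiTheta₂ hγ, Complex.ofReal_re]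

lemma continuous_ell {γ : ℝ} (hγ : 0 < γ) : Continuous (ell γ) :=
  continuous_iff_continuousAt.2 fun ξ => (analyticAt_ell hγ ξ).continuousAt

/-- An analytic non-constant function takes a given value finitely often on `[0,1]`. -/
lemma finite_ell_eq {γ : ℝ} (hγ : 0 < γ) {c : ℝ} (hc : c ≠ ell γ 0) :
    {ξ ∈ Icc (0 : ℝ) 1 | ell γ ξ = c}.Finite := by
  by_contra hinf
  obtain ⟨x, -, hx⟩ := Set.Infinite.exists_accPt_of_subset_isCompact hinf isCompact_Icc
    (fun y hy => hy.1)
  rw [accPt_iff_frequently_nhdsNE] at hx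
  have h1 : AnalyticOnNhd ℝ (ell γ) univ := fun y _ => analyticAt_ell hγ y
  have h2 : AnalyticOnNhd ℝ (fun _ : ℝ => c) univ := fun y _ => analyticAt_const
  have h3 := h1.eqOn_of_preconnected_of_frequently_eq h2 isPreconnected_univ (mem_univ x)
    (hx.mono fun y hy => hy.2)
  exact hc (h3 (mem_univ 0)).symm

/-! ### Eigenvalues and eigenvectors of the symbol -/

lemma CM_pos (γ : ℝ) : 0 < CM γ := by
  unfold CM
  positivity

lemma bSym_sub_aSym (γ ξ : ℝ) : bSym γ ξ - aSym γ ξ = CM γ * (ell γ ξ - ell γ 0) ^ 2 := by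
  simp only [aSym, bSym]; ring

lemma bSym_add_aSym (γ ξ : ℝ) :
    bSym γ ξ + aSym γ ξ = CM γ * ((ell γ ξ + ell γ 0) ^ 2 - 2 * ell γ 0 ^ 2) := by
  simp only [aSym, bSym]; ring

lemma Dsym_eq (γ ξ : ℝ) :
    Dsym γ ξ = (bSym γ ξ - aSym γ ξ) * (bSym γ ξ + aSym γ ξ) := by
  simp only [Dsym]; ring

lemma mu_sq (γ ξ : ℝ) : mu γ ξ ^ 2 = -(Dsym γ ξ : ℂ) := by
  have e : mu γ ξ ^ 2 = ((Real.sqrt (-Dsym γ ξ) ^ 2 - Real.sqrt (Dsym γ ξ) ^ 2 : ℝ) : ℂ) +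
      2 * Complex.I * ((Real.sqrt (-Dsym γ ξ) * Real.sqrt (Dsym γ ξ) : ℝ) : ℂ) := by
    simp only [mu]
    push_cast
    ring_nf
    simp only [Complex.I_sq]
    ring
  rw [e]
  rcases le_total 0 (Dsym γ ξ) with h | h
  · rw [Real.sqrt_eq_zero_of_nonpos (neg_nonpos.2 h), Real.sq_sqrt h]
    simp
  · rw [Real.sqrt_eq_zero_of_nonpos h, Real.sq_sqrt (neg_nonneg.2 h)]
    simp

lemma mu_re_eq_zero_of_pos {γ ξ : ℝ} (h : 0 < Dsym γ ξ) : (mu γ ξ).re = 0 ∧ mu γ ξ ≠ 0 := by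
  constructor
  · simp [mu, Real.sqrt_eq_zero_of_nonpos (neg_nonpos.2 h.le)]
  · intro h0
    have := mu_sq γ ξ
    rw [h0] at this
    have h1 : (Dsym γ ξ : ℂ) = 0 := by
      simpa using this.symm
    exact h.ne' (by exact_mod_cast h1)

lemma mu_eq_zero_iff_Dsym {γ ξ : ℝ} : mu γ ξ = 0 ↔ Dsym γ ξ = 0 := by
  constructor
  · intro h
    have := mu_sq γ ξ
    rw [h] at this
    have h1 : (Dsym γ ξ : ℂ) = 0 := by simpa using this.symm
    exact_mod_cast h1
  · intro h
    simp [mu, h]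

lemma Dsym_pos_of {γ ξ : ℝ} (hξ : ell γ ξ ≠ ell γ 0)
    (h : 0 < (ell γ ξ + ell γ 0) ^ 2 - 2 * ell γ 0 ^ 2) : 0 < Dsym γ ξ := by
  rw [Dsym_eq, bSym_sub_aSym, bSym_add_aSym]
  have := CM_pos γ
  have h2 : 0 < (ell γ ξ - ell γ 0) ^ 2 := by
    have := sub_ne_zero.2 hξ
    positivity
  positivity

lemma charpoly_Arect (γ ξ : ℝ) : (Arect γ ξ).charpoly =
    (Polynomial.X - Polynomial.C (mu γ ξ)) * (Polynomial.X - Polynomial.C (-mu γ ξ)) := by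
  have h := mu_sq γ ξ
  have e : (Polynomial.X - Polynomial.C (mu γ ξ)) * (Polynomial.X - Polynomial.C (-mu γ ξ)) =
      Polynomial.X ^ 2 - Polynomial.C (mu γ ξ ^ 2) := by
    simp only [map_neg, map_pow]
    ring
  rw [e, h, Matrix.charpoly_fin_two, Matrix.trace_fin_two, Matrix.det_fin_two]
  simp only [Arect, Dsym, Matrix.of_apply, Matrix.cons_val', Matrix.cons_val_zero,
    Matrix.cons_val_one, Matrix.cons_val_fin_one, add_neg_cancel, map_zero, zero_mul, sub_zero]
  push_cast
  rw [sub_eq_add_neg (Polynomial.X ^ 2) (Polynomial.C (-_)), ← map_neg]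
  congr 2
  ring

lemma det_Pmat (γ ξ : ℝ) : (Pmat γ ξ).det = -2 * (bSym γ ξ : ℂ) * mu γ ξ := by
  rw [Matrix.det_fin_two]
  simp [Pmat]
  ring

lemma bSym_pos {γ : ℝ} (hγ : 0 < γ) (ξ : ℝ) : 0 < bSym γ ξ := by
  have := ell_pos hγ ξ
  have := CM_pos γ
  unfold bSym
  positivity

lemma Arect_diagonalization {γ : ℝ} (hγ : 0 < γ) {ξ : ℝ} (h : mu γ ξ ≠ 0) :
    IsUnit (Pmat γ ξ).det ∧ Arect γ ξ = Pmat γ ξ *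
      Matrix.diagonal ![mu γ ξ, -mu γ ξ] * (Pmat γ ξ)⁻¹ := by
  have hb : (bSym γ ξ : ℂ) ≠ 0 := by exact_mod_cast (bSym_pos hγ ξ).ne'
  have hu : IsUnit (Pmat γ ξ).det := by
    rw [det_Pmat]
    refine isUnit_iff_ne_zero.2 ?_
    simp [hb, h]
  refine ⟨hu, ?_⟩
  have hμ := mu_sq γ ξ
  simp only [Dsym] at hμ
  push_cast at hμ
  have e : Arect γ ξ * Pmat γ ξ = Pmat γ ξ * Matrix.diagonal ![mu γ ξ, -mu γ ξ] := by
    ext i j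
    fin_cases i <;> fin_cases j <;>
      simp [Arect, Pmat, Matrix.mul_apply, Fin.sum_univ_two] <;>
      first
        | ring1
        | linear_combination (-1) * hμ
  rw [← e, Matrix.mul_nonsing_inv_cancel_right _ _ hu]

lemma mu_eq_zero_iff {γ : ℝ} (hγ : 0 < γ) (ξ : ℝ) : mu γ ξ = 0 ↔
    (∃ k : ℤ, ξ = k) ∨ ell γ ξ = (Real.sqrt 2 - 1) * ell γ 0 := by
  have hC := (CM_pos γ).ne'
  have h0 := ell_zero_pos hγ
  have h1 := ell_pos hγ ξ
  have hs : Real.sqrt 2 ^ 2 = 2 := Real.sq_sqrt (by norm_num)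
  have hs0 : 0 ≤ Real.sqrt 2 := Real.sqrt_nonneg 2
  rw [mu_eq_zero_iff_Dsym, Dsym_eq, bSym_sub_aSym, bSym_add_aSym, ← ell_eq_ell_zero_iff hγ,
    mul_eq_zero]
  refine or_congr ?_ ?_
  · simp [hC, sub_eq_zero]
  · have e : (ell γ ξ + ell γ 0) ^ 2 - 2 * ell γ 0 ^ 2 =
        (ell γ ξ - (Real.sqrt 2 - 1) * ell γ 0) * (ell γ ξ + (Real.sqrt 2 + 1) * ell γ 0) := by
      linear_combination (ell γ 0 ^ 2) * hs
    have h2 : ell γ ξ + (Real.sqrt 2 + 1) * ell γ 0 ≠ 0 := by positivity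
    rw [e]
    simp [hC, h2, sub_eq_zero]

lemma finite_mu_eq_zero {γ : ℝ} (hγ : 0 < γ) :
    {ξ ∈ Set.Icc (0 : ℝ) 1 | mu γ ξ = 0}.Finite := by
  have h0 := ell_zero_pos hγ
  have hc : (Real.sqrt 2 - 1) * ell γ 0 ≠ ell γ 0 := by
    intro h
    have hs : Real.sqrt 2 ^ 2 = 2 := Real.sq_sqrt (by norm_num)
    have : Real.sqrt 2 = 2 := by
      have : (Real.sqrt 2 - 2) * ell γ 0 = 0 := by linarith
      rcases mul_eq_zero.1 this with h | h <;> linarith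
    rw [this] at hs
    norm_num at hs
  refine ((finite_ell_eq hγ hc).union (Set.toFinite {0, 1})).subset ?_
  rintro ξ ⟨hξ, hmu⟩
  rcases (mu_eq_zero_iff hγ ξ).1 hmu with ⟨k, rfl⟩ | h
  · right
    have h1 : (0 : ℤ) ≤ k := by exact_mod_cast hξ.1
    have h2 : k ≤ 1 := by exact_mod_cast hξ.2
    interval_cases k <;> simp
  · exact Or.inl ⟨hξ, h⟩

lemma exists_bSym_gt_abs_aSym {γ : ℝ} (hγ : 0 < γ) :
    ∃ δ > 0, ∀ ξ : ℝ, 0 < |ξ| → |ξ| < δ →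
      0 < bSym γ ξ - aSym γ ξ ∧ 0 < bSym γ ξ + aSym γ ξ := by
  have h0 := ell_zero_pos hγ
  have hcont : Continuous fun ξ => (ell γ ξ + ell γ 0) ^ 2 - 2 * ell γ 0 ^ 2 := by
    have := continuous_ell hγ
    fun_prop
  have hpos : 0 < (ell γ 0 + ell γ 0) ^ 2 - 2 * ell γ 0 ^ 2 := by
    have : 0 < 2 * ell γ 0 ^ 2 := by positivity
    linarith
  obtain ⟨δ, hδ, h⟩ := Metric.eventually_nhds_iff.1 (hcont.continuousAt.eventually_const_lt hpos)
  refine ⟨min δ 1, by positivity, fun ξ h1 h2 => ?_⟩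
  have h3 := h (y := ξ) (by simpa using lt_of_lt_of_le h2 (min_le_left _ _))
  have h4 : ell γ ξ ≠ ell γ 0 := by
    intro he
    obtain ⟨k, rfl⟩ := (ell_eq_ell_zero_iff hγ ξ).1 he
    have h5 : |(k : ℝ)| < 1 := lt_of_lt_of_le h2 (min_le_right _ _)
    have h6 : |k| < 1 := by exact_mod_cast h5
    rw [Int.abs_lt_one_iff] at h6
    simp [h6] at h1
  have := CM_pos γ
  rw [bSym_sub_aSym, bSym_add_aSym]
  have h7 : 0 < (ell γ ξ - ell γ 0) ^ 2 := by
    have := sub_ne_zero.2 h4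
    positivity
  exact ⟨by positivity, by positivity⟩

/-- On the square lattice `θ_k = exp(-πk²)`, and a geometric bound on `∑ θ_k` keeps `ℓ` well above
`(√2 - 1) ℓ(0)`. -/
lemma Dsym_pos_of_square {γ : ℝ} (hγ : 0 < γ) (hτ : tau γ = Complex.I) {ξ : ℝ}
    (hξ : ¬ ∃ k : ℤ, ξ = k) : 0 < Dsym γ ξ := by
  have hπ3 := Real.pi_gt_three
  have hγ2 : γ ^ 2 = Real.pi := by
    have h1 : (γ : ℂ) ≠ 0 := by exact_mod_cast hγ.ne'
    rw [tau, div_eq_iff (by positivity), mul_right_inj' Complex.I_ne_zero] at hτ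
    exact_mod_cast hτ.symm
  set s : ℕ → ℝ := fun k => Real.exp (-(Real.pi ^ 2 * ((k : ℝ) + 1) ^ 2 / γ ^ 2)) with hs
  have hs_le : ∀ k, s k ≤ (1 / 8 : ℝ) * (1 / 8) ^ k := by
    intro k
    -- `π > 3` and `e ≥ 2` give the ratio `1/8`.
    have e2 : Real.exp (-3 : ℝ) ≤ 1 / 8 := by
      rw [Real.exp_neg, one_div]
      refine inv_anti₀ (by norm_num) ?_
      have h2 : (2 : ℝ) ≤ Real.exp 1 := by linarith [Real.add_one_le_exp (1 : ℝ)]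
      calc (8 : ℝ) = 2 ^ 3 := by norm_num
        _ ≤ Real.exp 1 ^ 3 := by gcongr
        _ = Real.exp 3 := by rw [← Real.exp_nat_mul]; norm_num
    calc s k ≤ Real.exp ((k + 1 : ℕ) * (-3 : ℝ)) := by
          rw [hs]
          refine Real.exp_le_exp.2 ?_
          rw [hγ2]
          have : Real.pi ^ 2 * ((k : ℝ) + 1) ^ 2 / Real.pi = Real.pi * ((k : ℝ) + 1) ^ 2 := by
            field_simp
          rw [this]
          push_cast
          have hk : (0 : ℝ) ≤ k := Nat.cast_nonneg k
          nlinarith [mul_nonneg hk hk]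
      _ = Real.exp (-3) ^ (k + 1) := by rw [Real.exp_nat_mul]
      _ ≤ (1 / 8) ^ (k + 1) := by gcongr
      _ = _ := by ring
  have hg : HasSum (fun k : ℕ => (1 / 8 : ℝ) * (1 / 8) ^ k) (1 / 7) := by
    have := (hasSum_geometric_of_lt_one (r := (1 / 8 : ℝ)) (by norm_num) (by norm_num)).mul_left
      (1 / 8 : ℝ)
    norm_num at this ⊢
    exact this
  have habs : ∀ η : ℝ, |ell γ η - 1| ≤ 2 / 7 := by
    intro η
    have h1 : ‖∑' k : ℕ, s k * Real.cos (2 * Real.pi * ((k : ℝ) + 1) * η)‖ ≤ 1 / 7 := by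
      refine tsum_of_norm_bounded hg fun k => ?_
      rw [norm_mul, Real.norm_of_nonneg (Real.exp_pos _).le]
      refine le_trans (mul_le_of_le_one_right (Real.exp_pos _).le (Real.abs_cos_le_one _)) (hs_le k)
    rw [ell, add_sub_cancel_left, abs_mul, abs_two]
    rw [Real.norm_eq_abs] at h1
    linarith
  have h0 := abs_le.1 (habs 0)
  have h1 := abs_le.1 (habs ξ)
  refine Dsym_pos_of (fun h => hξ ((ell_eq_ell_zero_iff hγ ξ).1 h)) ?_
  nlinarith

/-! ### Square-summable sequences and Fourier series on `[0,1]` -/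

/-- The squared `ℓ²(ℤ)` norm, with values in `[0, ∞]`. -/
def sqNorm (c : ℤ → ℂ) : ENNReal := ∑' n, ‖c n‖ₑ ^ 2

lemma eLpNorm_two_sq {X : Type*} [MeasurableSpace X] (μ : Measure X) (f : X → ℂ) :
    eLpNorm f 2 μ ^ 2 = ∫⁻ x, ‖f x‖ₑ ^ 2 ∂μ := by
  have h := eLpNorm_nnreal_pow_eq_lintegral (f := f) (μ := μ) (p := 2) (by norm_num)
  rw [← ENNReal.rpow_natCast]
  simp only [NNReal.coe_ofNat, ENNReal.rpow_ofNat] at h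
  simp only [Nat.cast_ofNat, ENNReal.rpow_ofNat]
  exact h

lemma tendsto_zero_iff_sq {ι : Type*} {l : Filter ι} {F : ι → ENNReal} :
    Tendsto F l (𝓝 0) ↔ Tendsto (fun i => F i ^ 2) l (𝓝 0) := by
  constructor
  · intro h
    simpa using ENNReal.Tendsto.pow (n := 2) h
  · intro h
    have h1 := h.ennrpow_const (1 / 2)
    have : (0 : ENNReal) ^ (1 / 2 : ℝ) = 0 := by simp
    rw [this] at h1
    refine h1.congr fun i => ?_
    rw [← ENNReal.rpow_natCast, ← ENNReal.rpow_mul]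
    norm_num

lemma enorm_sq_le_sqNorm (c : ℤ → ℂ) (n : ℤ) : ‖c n‖ₑ ^ 2 ≤ sqNorm c := ENNReal.le_tsum n

lemma summable_of_sqNorm {c : ℤ → ℂ} (hc : sqNorm c ≠ ⊤) : Summable fun n => ‖c n‖ ^ 2 := by
  have h := ENNReal.summable_toReal hc
  simpa using h

lemma sqNorm_eq_ofReal {c : ℤ → ℂ} {r : ℝ} (h : HasSum (fun n => ‖c n‖ ^ 2) r) :
    sqNorm c = ENNReal.ofReal r := by
  rw [← h.tsum_eq, ENNReal.ofReal_tsum_of_nonneg (fun n => by positivity) h.summable]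
  refine tsum_congr fun n => ?_
  rw [ENNReal.ofReal_pow (norm_nonneg _), ofReal_norm]

lemma exists_norm_le_of_sqNorm {c : ℤ → ℂ} (hc : sqNorm c ≠ ⊤) : ∃ M, ∀ n, ‖c n‖ ≤ M := by
  refine ⟨Real.sqrt (∑' n, ‖c n‖ ^ 2), fun n => Real.le_sqrt_of_sq_le ?_⟩
  exact (summable_of_sqNorm hc).le_tsum n fun _ _ => by positivity

lemma sqNorm_neg_index (c : ℤ → ℂ) : sqNorm (fun n => c (-n)) = sqNorm c :=
  (Equiv.neg ℤ).tsum_eq fun n => ‖c n‖ₑ ^ 2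

lemma sqNorm_conj (c : ℤ → ℂ) : sqNorm (fun n => conj (c n)) = sqNorm c := by
  simp only [sqNorm]
  refine tsum_congr fun n => ?_
  rw [← ofReal_norm, ← ofReal_norm, RCLike.norm_conj]

/-- The finite truncations of `c` converge to `a` in `ℓ²` exactly when `a = c`. -/
lemma tendsto_sqNorm_truncation_iff {a c : ℤ → ℂ} (ha : sqNorm a ≠ ⊤) :
    Tendsto (fun s : Finset ℤ => sqNorm fun n => a n - if n ∈ s then c n else 0) atTop (𝓝 0) ↔
      a = c := by
  constructor
  · intro h
    funext n
    have h1 : Tendsto (fun _ : Finset ℤ => ‖a n - c n‖ₑ ^ 2) atTop (𝓝 0) := by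
      refine tendsto_of_tendsto_of_tendsto_of_le_of_le' tendsto_const_nhds h
        (Eventually.of_forall fun _ => zero_le) ?_
      filter_upwards [eventually_ge_atTop {n}] with s hs
      have hn : n ∈ s := hs (Finset.mem_singleton_self n)
      have := enorm_sq_le_sqNorm (fun n => a n - if n ∈ s then c n else 0) n
      simpa [hn] using this
    have h2 := tendsto_nhds_unique h1 tendsto_const_nhds
    rw [eq_comm, pow_eq_zero_iff two_ne_zero, enorm_eq_zero, sub_eq_zero] at h2
    exact h2
  · rintro rfl
    refine (ENNReal.tendsto_tsum_compl_atTop_zero ha).congr fun s => ?_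
    refine (tsum_subtype {n | n ∉ s} fun n => ‖a n‖ₑ ^ 2).trans ?_
    refine tsum_congr fun n => ?_
    by_cases hn : n ∈ s <;> simp [hn]

instance : IsFiniteMeasure unitMeasure := by
  unfold unitMeasure; infer_instance

lemma unitMeasure_eq_Ioc : unitMeasure = volume.restrict (Ioc (0 : ℝ) 1) :=
  restrict_Ioc_eq_restrict_Icc.symm

lemma integral_unitMeasure {E : Type*} [NormedAddCommGroup E] [NormedSpace ℝ E] (f : ℝ → E) :
    ∫ x, f x ∂unitMeasure = ∫ x in (0 : ℝ)..1, f x := by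
  rw [unitMeasure_eq_Ioc, intervalIntegral.integral_of_le zero_le_one]

/-- The Fourier mode `exp(-2πinξ)`. -/
def fmode (n : ℤ) (ξ : ℝ) : ℂ := Complex.exp (-2 * Real.pi * Complex.I * n * ξ)

lemma continuous_fmode (n : ℤ) : Continuous (fmode n) := by unfold fmode; fun_prop

lemma norm_fmode (n : ℤ) (ξ : ℝ) : ‖fmode n ξ‖ = 1 := by
  have : fmode n ξ = Complex.exp (((-2 * Real.pi * n * ξ : ℝ) : ℂ) * Complex.I) := by
    unfold fmode; congr 1; push_cast; ring
  rw [this, Complex.norm_exp_ofReal_mul_I]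

lemma fmode_mul (m n : ℤ) (ξ : ℝ) : fmode m ξ * fmode n ξ = fmode (m + n) ξ := by
  simp only [fmode, ← Complex.exp_add]
  congr 1; push_cast; ring

lemma fmode_neg_right (n : ℤ) (ξ : ℝ) : fmode n (-ξ) = fmode (-n) ξ := by
  simp only [fmode]; congr 1; push_cast; ring

lemma conj_fmode (n : ℤ) (ξ : ℝ) : conj (fmode n ξ) = fmode (-n) ξ := by
  simp only [fmode, ← Complex.exp_conj]
  congr 1
  simp only [map_mul, map_neg, Complex.conj_I, Complex.conj_ofReal, map_ofNat, map_intCast]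
  push_cast
  ring

lemma fmode_periodic (n : ℤ) : Function.Periodic (fmode n) 1 := by
  intro ξ
  simp only [fmode]
  rw [Complex.exp_eq_exp_iff_exists_int]
  exact ⟨-n, by push_cast; ring⟩

/-- The coefficient `∫₀¹ f(ξ) exp(2πinξ) dξ`, dual to the modes `exp(-2πinξ)`. -/
def fcoef (f : ℝ → ℂ) (n : ℤ) : ℂ := ∫ ξ, fmode (-n) ξ * f ξ ∂unitMeasure

lemma fourierCoeffOn_eq_fcoef (f : ℝ → ℂ) (n : ℤ) :
    fourierCoeffOn (zero_lt_one (α := ℝ)) f n = fcoef f (-n) := by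
  rw [fourierCoeffOn_eq_integral, fcoef, integral_unitMeasure]
  simp only [sub_zero, one_div, inv_one, one_smul, neg_neg]
  refine intervalIntegral.integral_congr fun x _ => ?_
  simp only [smul_eq_mul]
  congr 1
  rw [fmode, fourier_coe_apply]
  congr 1
  push_cast
  ring

/-- Parseval's identity on `[0,1]`. -/
lemma eLpNorm_sq_eq_sqNorm_fcoef {f : ℝ → ℂ} (hf : MemLp f 2 unitMeasure) :
    eLpNorm f 2 unitMeasure ^ 2 = sqNorm (fcoef f) := by
  have h := hasSum_sq_fourierCoeffOn (zero_lt_one (α := ℝ)) (unitMeasure_eq_Ioc ▸ hf)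
  simp only [fourierCoeffOn_eq_fcoef, sub_zero, inv_one, one_smul] at h
  rw [← sqNorm_neg_index, sqNorm_eq_ofReal h, eLpNorm_two_sq, ← integral_unitMeasure,
    ofReal_integral_eq_lintegral_ofReal]
  · refine lintegral_congr fun x => ?_
    rw [ENNReal.ofReal_pow (norm_nonneg _), ofReal_norm]
  · exact hf.integrable_norm_pow (by norm_num)
  · exact Eventually.of_forall fun x => by positivity

lemma integrable_fmode_mul {f : ℝ → ℂ} (hf : Integrable f unitMeasure) (n : ℤ) :
    Integrable (fun ξ => fmode n ξ * f ξ) unitMeasure :=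
  hf.bdd_mul (c := 1) (continuous_fmode n).aestronglyMeasurable
    (Eventually.of_forall fun ξ => (norm_fmode n ξ).le)

lemma integrable_of_memLp {f : ℝ → ℂ} (hf : MemLp f 2 unitMeasure) : Integrable f unitMeasure :=
  hf.integrable (by norm_num)

lemma memLp_fmode (n : ℤ) : MemLp (fmode n) 2 unitMeasure :=
  MemLp.of_bound (continuous_fmode n).aestronglyMeasurable 1
    (Eventually.of_forall fun ξ => (norm_fmode n ξ).le)

lemma fcoef_add {f g : ℝ → ℂ} (hf : MemLp f 2 unitMeasure) (hg : MemLp g 2 unitMeasure) (n : ℤ) :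
    fcoef (fun ξ => f ξ + g ξ) n = fcoef f n + fcoef g n := by
  simp only [fcoef, mul_add]
  exact integral_add (integrable_fmode_mul (integrable_of_memLp hf) _)
    (integrable_fmode_mul (integrable_of_memLp hg) _)

lemma fcoef_const_mul (a : ℂ) (f : ℝ → ℂ) (n : ℤ) :
    fcoef (fun ξ => a * f ξ) n = a * fcoef f n := by
  simp only [fcoef, mul_left_comm _ a]
  exact integral_const_mul a _

lemma fcoef_fmode (m n : ℤ) : fcoef (fmode m) n = if n = m then 1 else 0 := by
  rw [fcoef]
  simp only [fmode_mul]
  split_ifs with h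
  · subst h
    simp [fmode, unitMeasure]
  · rw [integral_unitMeasure]
    have hk : (-n + m) ≠ 0 := by omega
    have hc : (-2 * Real.pi * Complex.I * ((-n + m : ℤ) : ℂ)) ≠ 0 := by
      have : ((-n + m : ℤ) : ℂ) ≠ 0 := by exact_mod_cast hk
      have := Real.pi_ne_zero
      simp_all
    have := integral_exp_mul_complex (a := 0) (b := 1) hc
    simp only [fmode]
    rw [this]
    have e := fmode_periodic (-n + m) 0
    simp only [fmode, zero_add] at e
    rw [e]
    simp

lemma fcoef_sub_sum {f : ℝ → ℂ} (hf : MemLp f 2 unitMeasure) (c : ℤ → ℂ) (s : Finset ℤ) :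
    MemLp (fun ξ => f ξ - ∑ n ∈ s, c n * fmode n ξ) 2 unitMeasure ∧
    ∀ n, fcoef (fun ξ => f ξ - ∑ n ∈ s, c n * fmode n ξ) n =
      fcoef f n - if n ∈ s then c n else 0 := by
  induction s using Finset.induction_on with
  | empty => simpa using hf
  | insert m s hm ih =>
    have e : (fun ξ => f ξ - ∑ n ∈ insert m s, c n * fmode n ξ) = fun ξ =>
        (f ξ - ∑ n ∈ s, c n * fmode n ξ) + (-c m) * fmode m ξ := by
      funext ξ
      rw [Finset.sum_insert hm]
      ring
    have hm2 : MemLp (fun ξ => (-c m) * fmode m ξ) 2 unitMeasure := (memLp_fmode m).const_mul _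
    rw [e]
    refine ⟨ih.1.add hm2, fun n => ?_⟩
    rw [fcoef_add ih.1 hm2, ih.2, fcoef_const_mul, fcoef_fmode]
    by_cases h : n = m
    · subst h
      simp [hm, sub_eq_add_neg]
    · simp [h]

/-- Convergence of the series in `L²([0,1])` means that `c` is the sequence of Fourier coefficients
of `f`. -/
lemma hasDFT_iff {f : ℝ → ℂ} {c : ℤ → ℂ} :
    HasDFT f c ↔ Function.Periodic f 1 ∧ MemLp f 2 unitMeasure ∧ fcoef f = c := by
  unfold HasDFT
  refine and_congr_right fun _ => and_congr_right fun hf => ?_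
  rw [tendsto_zero_iff_sq]
  have hfin : sqNorm (fcoef f) ≠ ⊤ := by
    rw [← eLpNorm_sq_eq_sqNorm_fcoef hf]
    exact ENNReal.pow_ne_top hf.2.ne
  rw [← tendsto_sqNorm_truncation_iff hfin]
  refine tendsto_congr fun s => ?_
  have h := fcoef_sub_sum hf c s
  have h2 := eLpNorm_sq_eq_sqNorm_fcoef h.1
  rw [funext h.2] at h2
  exact h2

lemma HasDFT.eLpNorm_sq {f : ℝ → ℂ} {c : ℤ → ℂ} (h : HasDFT f c) :
    eLpNorm f 2 unitMeasure ^ 2 = sqNorm c := by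
  obtain ⟨-, h2, rfl⟩ := hasDFT_iff.1 h
  exact eLpNorm_sq_eq_sqNorm_fcoef h2

lemma HasDFT.sqNorm_ne_top {f : ℝ → ℂ} {c : ℤ → ℂ} (h : HasDFT f c) : sqNorm c ≠ ⊤ := by
  rw [← h.eLpNorm_sq]
  exact ENNReal.pow_ne_top h.2.1.2.ne

lemma HasDFT.add {f g : ℝ → ℂ} {c d : ℤ → ℂ} (hf : HasDFT f c) (hg : HasDFT g d) :
    HasDFT (fun ξ => f ξ + g ξ) (fun n => c n + d n) := by
  obtain ⟨h1, h2, rfl⟩ := hasDFT_iff.1 hf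
  obtain ⟨h3, h4, rfl⟩ := hasDFT_iff.1 hg
  exact hasDFT_iff.2 ⟨fun ξ => by simp only [h1 ξ, h3 ξ], h2.add h4,
    funext fun n => fcoef_add h2 h4 n⟩

lemma HasDFT.const_mul {f : ℝ → ℂ} {c : ℤ → ℂ} (hf : HasDFT f c) (a : ℂ) :
    HasDFT (fun ξ => a * f ξ) (fun n => a * c n) := by
  obtain ⟨h1, h2, rfl⟩ := hasDFT_iff.1 hf
  exact hasDFT_iff.2 ⟨fun ξ => by simp only [h1 ξ], h2.const_mul a,
    funext fun n => fcoef_const_mul a f n⟩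

lemma HasDFT.sub {f g : ℝ → ℂ} {c d : ℤ → ℂ} (hf : HasDFT f c) (hg : HasDFT g d) :
    HasDFT (fun ξ => f ξ - g ξ) (fun n => c n - d n) := by
  simpa [sub_eq_add_neg] using hf.add (hg.const_mul (-1))

lemma measurePreserving_one_sub_unitMeasure :
    MeasurePreserving (fun x : ℝ => 1 - x) unitMeasure unitMeasure := by
  have h := (Measure.measurePreserving_sub_left (volume : Measure ℝ) 1).restrict_preimage
    (s := Icc (0 : ℝ) 1) measurableSet_Icc
  have e : (fun x : ℝ => 1 - x) ⁻¹' Icc (0 : ℝ) 1 = Icc 0 1 := by simp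
  rwa [e] at h

lemma neg_eq_one_sub_of_periodic {f : ℝ → ℂ} (h : Function.Periodic f 1) (ξ : ℝ) :
    f (-ξ) = f (1 - ξ) := by
  rw [← h (-ξ)]; congr 1; ring

/-- For a 1-periodic function, the reflection `ξ ↦ -ξ` amounts to `ξ ↦ 1 - ξ`, which preserves
`[0,1]`. -/
lemma eLpNorm_conj_neg {f : ℝ → ℂ} (h : Function.Periodic f 1)
    (hf : AEStronglyMeasurable f unitMeasure) :
    eLpNorm (fun ξ => conj (f (-ξ))) 2 unitMeasure = eLpNorm f 2 unitMeasure := by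
  rw [← eLpNorm_comp_measurePreserving hf measurePreserving_one_sub_unitMeasure]
  refine eLpNorm_congr_norm_ae (Eventually.of_forall fun ξ => ?_)
  simp [neg_eq_one_sub_of_periodic h]

/-- The map `f(ξ) ↦ conj f(-ξ)` conjugates the Fourier coefficients. -/
lemma HasDFT.conj_neg {f : ℝ → ℂ} {c : ℤ → ℂ} (hf : HasDFT f c) :
    HasDFT (fun ξ => conj (f (-ξ))) (fun n => conj (c n)) := by
  obtain ⟨h1, h2, h3⟩ := hf
  refine ⟨fun ξ => ?_, ⟨?_, ?_⟩, ?_⟩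
  · dsimp only
    rw [← h1 (-(ξ + 1))]
    congr 2
    ring
  · have := h2.1.comp_measurePreserving measurePreserving_one_sub_unitMeasure
    refine (Complex.continuous_conj.comp_aestronglyMeasurable this).congr
      (Eventually.of_forall fun ξ => ?_)
    simp [neg_eq_one_sub_of_periodic h1]
  · rw [eLpNorm_conj_neg h1 h2.1]
    exact h2.2
  · refine h3.congr fun s => ?_
    have hper : Function.Periodic (fun ξ => f ξ - ∑ n ∈ s, c n * fmode n ξ) 1 := fun ξ => by
      simp only [h1 ξ, fmode_periodic _ ξ]
    have := eLpNorm_conj_neg hper (fcoef_sub_sum h2 c s).1.1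
    simp only [fmode] at this
    rw [← this]
    congr 1
    funext ξ
    rw [map_sub, map_sum]
    congr 1
    refine Finset.sum_congr rfl fun n _ => ?_
    rw [map_mul]
    congr 1
    have := conj_fmode n (-ξ)
    rw [fmode_neg_right (-n), neg_neg] at this
    simpa only [fmode] using this

/-- Convolution with the weights `θ_n`. -/
def thetaConv (γ : ℝ) (c : ℤ → ℂ) (n : ℤ) : ℂ := ∑' j : ℤ, (theta γ j : ℂ) * c (n - j)

lemma hasSum_ell_fmode {γ : ℝ} (hγ : 0 < γ) (ξ : ℝ) :
    HasSum (fun n : ℤ => (theta γ n : ℂ) * fmode n ξ) (ell γ ξ) := by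
  have h := hasSum_ell hγ (-ξ)
  rw [ell_neg] at h
  have e : ∀ n : ℤ, Complex.exp (2 * Real.pi * Complex.I * n * ((-ξ : ℝ) : ℂ)) = fmode n ξ := by
    intro n
    unfold fmode
    congr 1
    push_cast
    ring
  simpa only [e] using h

/-- Multiplication by `ℓ` is convolution with its Fourier coefficients. -/
lemma HasDFT.ell_mul {γ : ℝ} (hγ : 0 < γ) {f : ℝ → ℂ} {c : ℤ → ℂ} (hf : HasDFT f c) :
    HasDFT (fun ξ => (ell γ ξ : ℂ) * f ξ) (thetaConv γ c) := by
  obtain ⟨h1, h2, rfl⟩ := hasDFT_iff.1 hf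
  refine hasDFT_iff.2 ⟨fun ξ => by simp only [h1 ξ, ell_add_one], ?_, ?_⟩
  · have hc : Continuous fun ξ => (ell γ ξ : ℂ) :=
      Complex.continuous_ofReal.comp (continuous_ell hγ)
    refine h2.mul (p := ⊤) (r := 2) (MemLp.of_bound hc.aestronglyMeasurable (ell γ 0)
      (Eventually.of_forall fun ξ => ?_))
    rw [Complex.norm_real, Real.norm_of_nonneg (ell_pos hγ ξ).le]
    exact ell_le hγ ξ
  · funext n
    have hi := integrable_of_memLp h2
    have hF : ∀ j : ℤ, Integrable (fun ξ => (theta γ j : ℂ) * (fmode (-(n - j)) ξ * f ξ))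
        unitMeasure := fun j => (integrable_fmode_mul hi _).const_mul _
    have hS : Summable fun j : ℤ =>
        ∫ ξ, ‖(theta γ j : ℂ) * (fmode (-(n - j)) ξ * f ξ)‖ ∂unitMeasure := by
      refine ((summable_theta hγ).mul_right (∫ ξ, ‖f ξ‖ ∂unitMeasure)).congr fun j => ?_
      rw [← integral_const_mul]
      refine integral_congr_ae (Eventually.of_forall fun ξ => ?_)
      simp [norm_fmode, abs_of_pos (theta_pos γ j)]
    have h := hasSum_integral_of_summable_integral_norm hF hS
    have h3 := h.tsum_eq
    simp only [integral_const_mul] at h3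
    rw [thetaConv, fcoef]
    simp only [fcoef]
    rw [h3]
    refine integral_congr_ae (Eventually.of_forall fun ξ => ?_)
    have h4 := (hasSum_ell_fmode hγ ξ).mul_right (fmode (-n) ξ * f ξ)
    dsimp only
    rw [mul_left_comm, ← h4.tsum_eq]
    refine tsum_congr fun j => ?_
    rw [mul_assoc, ← mul_assoc (fmode j ξ), fmode_mul]
    congr 3
    ring

/-- The Riesz–Fischer theorem for 1-periodic functions. -/
lemma exists_hasDFT {c : ℤ → ℂ} (hc : sqNorm c ≠ ⊤) : ∃ f, HasDFT f c := by
  have : Fact ((0 : ℝ) < 1) := ⟨one_pos⟩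
  have hc' : sqNorm (fun n => c (-n)) ≠ ⊤ := by rwa [sqNorm_neg_index]
  have hmem : Memℓp (fun n => c (-n)) 2 := by
    refine memℓp_gen ?_
    simpa using summable_of_sqNorm hc'
  set F := (fourierBasis (T := 1)).repr.symm ⟨_, hmem⟩ with hF
  have hcoef : ∀ n, fourierCoeff F n = c (-n) := by
    intro n
    rw [← fourierBasis_repr, hF, LinearIsometryEquiv.apply_symm_apply]
  have hvol : (volume : Measure (AddCircle (1 : ℝ))) = AddCircle.haarAddCircle := by
    simpa using AddCircle.volume_eq_smul_haarAddCircle (T := 1)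
  have hmp : MeasurePreserving (fun x : ℝ => (x : AddCircle (1 : ℝ))) unitMeasure
      AddCircle.haarAddCircle := by
    have := AddCircle.measurePreserving_mk 1 0
    rw [zero_add, hvol] at this
    rwa [unitMeasure_eq_Ioc]
  refine ⟨fun ξ => F (ξ : AddCircle (1 : ℝ)), hasDFT_iff.2 ⟨fun ξ => ?_, ?_, ?_⟩⟩
  · simp
  · exact (Lp.memLp F).comp_measurePreserving hmp
  · funext n
    have := hcoef (-n)
    rw [neg_neg, fourierCoeff_eq_intervalIntegral F (-n) 0] at this
    rw [← this, fcoef, integral_unitMeasure]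
    simp only [zero_add, one_div, inv_one, one_smul, neg_neg, smul_eq_mul]
    refine intervalIntegral.integral_congr fun x _ => ?_
    congr 1
    rw [fmode, fourier_coe_apply]
    congr 1
    push_cast
    ring

/-! ### The modes `ψ_n` and their superpositions -/

/-- The ordinate shift `β_n = nπ/γ`: `|ψ_n|` is a Gaussian in `y` centred at `-β_n`. -/
def beta (γ : ℝ) (n : ℤ) : ℝ := n * Real.pi / γ

/-- The normalizing constant of `ψ_n`. -/
def nrm (γ : ℝ) : ℝ := (2 / (Real.pi * γ ^ 2)) ^ (1 / 4 : ℝ)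

lemma beta_add (γ : ℝ) (m n : ℤ) : beta γ (m + n) = beta γ m + beta γ n := by
  simp only [beta]; push_cast; ring

lemma beta_sub (γ : ℝ) (m n : ℤ) : beta γ (m - n) = beta γ m - beta γ n := by
  simp only [beta]; push_cast; ring

lemma theta_eq_exp_beta (γ : ℝ) (n : ℤ) : theta γ n = Real.exp (-beta γ n ^ 2) := by
  simp only [theta, beta]; congr 1; ring

lemma nrm_pos {γ : ℝ} (hγ : 0 < γ) : 0 < nrm γ := by
  have := Real.pi_pos
  unfold nrm
  positivity

lemma nrm_sq {γ : ℝ} (hγ : 0 < γ) : nrm γ ^ 2 = Real.sqrt (2 / Real.pi) / γ := by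
  have hπ := Real.pi_pos
  have h0 : 0 ≤ 2 / (Real.pi * γ ^ 2) := by positivity
  rw [nrm, ← Real.rpow_natCast, ← Real.rpow_mul h0]
  have : 2 / (Real.pi * γ ^ 2) = (2 / Real.pi) / γ ^ 2 := by field_simp
  rw [this, show (1 / 4 : ℝ) * (2 : ℕ) = 1 / 2 by norm_num, ← Real.sqrt_eq_rpow,
    Real.sqrt_div (by positivity), Real.sqrt_sq hγ.le]

lemma norm_sq_re_im (z : ℂ) : ‖z‖ ^ 2 = z.re ^ 2 + z.im ^ 2 := by
  rw [← Complex.normSq_eq_norm_sq, Complex.normSq_apply]; ring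

/-- The modes in holomorphic form: up to `exp(-|z|²/2)`, they are `exp(z²/2)` times the terms of a
Jacobi theta series in `z/γ`. -/
lemma psi_eq_term (γ : ℝ) (n : ℤ) (z : ℂ) :
    psi γ n z = Complex.exp (-((‖z‖ ^ 2 : ℝ) : ℂ) / 2) *
      (nrm γ * Complex.exp (z ^ 2 / 2) * jacobiTheta₂_term n (z / γ) (tau γ)) := by
  rw [jacobiTheta₂_term_tau, theta_eq_exp_beta]
  have e : ((beta γ n : ℝ) : ℂ) = n * Real.pi / γ := by simp [beta]
  have h1 : Complex.I * n * Real.pi / γ = Complex.I * (beta γ n : ℝ) := by rw [e]; ring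
  have h2 : 2 * Real.pi * Complex.I * n * (z / γ) = 2 * Complex.I * (beta γ n : ℝ) * z := by
    rw [e]; ring
  rw [h2]
  simp only [psi, magTrans, psiZero, h1, nrm]
  set b := beta γ n
  rw [Complex.ofReal_exp]
  have key : (Complex.I * (b : ℂ) * conj z - conj (Complex.I * (b : ℂ)) * z) / 2 +
      ((z + Complex.I * b) ^ 2 / 2 - ((‖z + Complex.I * b‖ ^ 2 : ℝ) : ℂ) / 2) =
      -((‖z‖ ^ 2 : ℝ) : ℂ) / 2 + z ^ 2 / 2 + (((-b ^ 2 : ℝ) : ℂ) + 2 * Complex.I * b * z) := by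
    rw [norm_sq_re_im, norm_sq_re_im]
    apply Complex.ext <;> simp [sq] <;> ring
  rw [mul_left_comm, ← Complex.exp_add, key, Complex.exp_add, Complex.exp_add, Complex.exp_add]
  ring

/-- The modes in real coordinates. -/
lemma psi_coord (γ : ℝ) (n : ℤ) (x y : ℝ) :
    psi γ n (x + y * Complex.I) = Complex.exp (Complex.I * x * y) *
      (nrm γ * Real.exp (-(y + beta γ n) ^ 2) * fmode (-n) (x / γ)) := by
  rw [psi_eq_term, jacobiTheta₂_term_tau, theta_eq_exp_beta, fmode]
  have e : ((beta γ n : ℝ) : ℂ) = n * Real.pi / γ := by simp [beta]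
  have h2 : ∀ w : ℂ, 2 * Real.pi * Complex.I * n * (w / γ) = 2 * Complex.I * (beta γ n : ℝ) * w := by
    intro w; rw [e]; ring
  have h3 : -2 * Real.pi * Complex.I * ((-n : ℤ) : ℂ) * ((x / γ : ℝ) : ℂ)
      = 2 * Complex.I * (beta γ n : ℝ) * x := by
    rw [e]; push_cast; ring
  rw [h2, h3]
  set b := beta γ n
  rw [Complex.ofReal_exp, Complex.ofReal_exp]
  have key : -((‖(x + y * Complex.I : ℂ)‖ ^ 2 : ℝ) : ℂ) / 2 + (x + y * Complex.I) ^ 2 / 2 +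
      (((-b ^ 2 : ℝ) : ℂ) + 2 * Complex.I * b * (x + y * Complex.I)) =
      Complex.I * x * y + (((-(y + b) ^ 2 : ℝ) : ℂ) + 2 * Complex.I * b * x) := by
    rw [norm_sq_re_im]
    apply Complex.ext <;> simp [sq] <;> ring
  have : ∀ A B C D N : ℂ, Complex.exp A * (N * Complex.exp B * (Complex.exp C * Complex.exp D)) =
      N * Complex.exp (A + B + (C + D)) := by
    intro A B C D N; simp only [Complex.exp_add]; ring
  rw [this, key, Complex.exp_add, Complex.exp_add]
  ring

lemma norm_exp_I_mul (x y : ℝ) : ‖Complex.exp (Complex.I * x * y)‖ = 1 := by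
  rw [show Complex.I * x * y = ((x * y : ℝ) : ℂ) * Complex.I by push_cast; ring,
    Complex.norm_exp_ofReal_mul_I]

lemma norm_psi {γ : ℝ} (hγ : 0 < γ) (n : ℤ) (z : ℂ) :
    ‖psi γ n z‖ = nrm γ * Real.exp (-(z.im + beta γ n) ^ 2) := by
  conv_lhs => rw [← Complex.re_add_im z]
  rw [psi_coord, norm_mul, norm_exp_I_mul, norm_mul, norm_fmode, norm_mul, Complex.norm_real,
    Complex.norm_real, Real.norm_of_nonneg (nrm_pos hγ).le, Real.norm_of_nonneg (Real.exp_pos _).le]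
  ring

/-- The translates by `π/γ` of a Gaussian have a bounded sum. -/
lemma exists_gaussian_sum_le {γ : ℝ} (hγ : 0 < γ) : ∃ B : ℝ, 0 < B ∧ ∀ y : ℝ,
    Summable (fun n : ℤ => Real.exp (-(y + beta γ n) ^ 2)) ∧
      ∑' n : ℤ, Real.exp (-(y + beta γ n) ^ 2) ≤ B := by
  have hπ := Real.pi_pos
  have h2 : 0 < γ * Real.sqrt 2 := by positivity
  set d := Real.pi / γ with hd
  have hd0 : 0 < d := by positivity
  have hS := (summable_theta h2).mul_left (Real.exp (d ^ 2))
  have hterm : ∀ r : ℝ, 0 ≤ r → r ≤ d → ∀ n : ℤ, Real.exp (-(r + beta γ n) ^ 2) ≤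
      Real.exp (d ^ 2) * theta (γ * Real.sqrt 2) n := by
    intro r h0 h1 n
    rw [theta_eq_exp_beta, ← Real.exp_add]
    refine Real.exp_le_exp.2 ?_
    have : beta (γ * Real.sqrt 2) n ^ 2 = beta γ n ^ 2 / 2 := by
      simp only [beta, div_pow, mul_pow]
      rw [Real.sq_sqrt (by norm_num)]
      field_simp
    have hr : r ^ 2 ≤ d ^ 2 := by gcongr
    nlinarith [sq_nonneg (2 * r + beta γ n)]
  refine ⟨∑' n, Real.exp (d ^ 2) * theta (γ * Real.sqrt 2) n,
    hS.tsum_pos (fun n => by have := theta_pos (γ * Real.sqrt 2) n; positivity) 0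
      (by have := theta_pos (γ * Real.sqrt 2) 0; positivity), fun y => ?_⟩
  -- By periodicity in `y` of the whole sum, `y` can be brought into `[0, π/γ)`.
  set k := ⌊y / d⌋ with hk
  have e : ∀ n, y + beta γ n = (y - k * d) + beta γ (Equiv.addRight k n) := by
    intro n
    rw [Equiv.coe_addRight, beta_add, show beta γ k = k * d by simp only [beta, hd]; ring]
    ring
  have hr0 : 0 ≤ y - k * d := by
    have := Int.floor_le (y / d)
    rw [le_div_iff₀ hd0] at this
    linarith
  have hr1 : y - k * d ≤ d := by
    have := (Int.lt_floor_add_one (y / d)).le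
    rw [div_le_iff₀ hd0] at this
    linarith
  have hs : Summable fun n : ℤ => Real.exp (-((y - k * d) + beta γ n) ^ 2) :=
    Summable.of_nonneg_of_le (fun n => (Real.exp_pos _).le) (hterm _ hr0 hr1) hS
  simp only [e]
  refine ⟨(Equiv.addRight k).summable_iff.2 hs, ?_⟩
  rw [(Equiv.addRight k).tsum_eq fun n => Real.exp (-((y - k * d) + beta γ n) ^ 2)]
  exact hs.tsum_le_tsum (hterm _ hr0 hr1) hS

/-- The superposition `∑ c_n ψ_n`, as a pointwise sum. -/
def synth (γ : ℝ) (c : ℤ → ℂ) (z : ℂ) : ℂ := ∑' n, c n * psi γ n z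

lemma summable_norm_synth {γ : ℝ} (hγ : 0 < γ) {c : ℤ → ℂ} {M : ℝ} (hc : ∀ n, ‖c n‖ ≤ M) (z : ℂ) :
    Summable fun n => ‖c n * psi γ n z‖ := by
  obtain ⟨B, hB, h⟩ := exists_gaussian_sum_le hγ
  refine Summable.of_nonneg_of_le (fun n => norm_nonneg _) (fun n => ?_)
    (((h z.im).1.mul_left (nrm γ)).mul_left M)
  rw [norm_mul, norm_psi hγ]
  have := nrm_pos hγ
  gcongr
  exact hc n

lemma hasSum_synth {γ : ℝ} (hγ : 0 < γ) {c : ℤ → ℂ} {M : ℝ} (hc : ∀ n, ‖c n‖ ≤ M) (z : ℂ) :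
    HasSum (fun n => c n * psi γ n z) (synth γ c z) :=
  (summable_norm_synth hγ hc z).of_norm.hasSum

lemma exists_tsum_norm_synth_le {γ : ℝ} (hγ : 0 < γ) {c : ℤ → ℂ} {M : ℝ} (hc : ∀ n, ‖c n‖ ≤ M) :
    ∃ C, 0 ≤ C ∧ ∀ z, ∑' n, ‖c n * psi γ n z‖ ≤ C := by
  obtain ⟨B, hB, h⟩ := exists_gaussian_sum_le hγ
  have h0 := nrm_pos hγ
  have hM : 0 ≤ M := (norm_nonneg _).trans (hc 0)
  refine ⟨M * (nrm γ * B), by positivity, fun z => ?_⟩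
  have hs := ((h z.im).1.mul_left (nrm γ)).mul_left M
  refine ((summable_norm_synth hγ hc z).tsum_le_tsum (fun n => ?_) hs).trans ?_
  · rw [norm_mul, norm_psi hγ]
    gcongr
    exact hc n
  · rw [tsum_mul_left, tsum_mul_left]
    gcongr
    exact (h z.im).2

lemma exists_norm_synth_le {γ : ℝ} (hγ : 0 < γ) {c : ℤ → ℂ} {M : ℝ} (hc : ∀ n, ‖c n‖ ≤ M) :
    ∃ C, ∀ z, ‖synth γ c z‖ ≤ C := by
  obtain ⟨C, -, hC⟩ := exists_tsum_norm_synth_le hγ hc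
  exact ⟨C, fun z => (norm_tsum_le_tsum_norm (summable_norm_synth hγ hc z)).trans (hC z)⟩

/-- The entire factor of `synth γ c`. -/
def synthHol (γ : ℝ) (c : ℤ → ℂ) (z : ℂ) : ℂ :=
  nrm γ * Complex.exp (z ^ 2 / 2) * ∑' n, c n * jacobiTheta₂_term n (z / γ) (tau γ)

lemma synth_eq_synthHol (γ : ℝ) (c : ℤ → ℂ) (z : ℂ) :
    synth γ c z = Complex.exp (-((‖z‖ ^ 2 : ℝ) : ℂ) / 2) * synthHol γ c z := by
  rw [synth, synthHol, ← tsum_mul_left, ← tsum_mul_left]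
  refine tsum_congr fun n => ?_
  rw [psi_eq_term]
  ring

lemma differentiable_synthHol {γ : ℝ} (hγ : 0 < γ) {c : ℤ → ℂ} {M : ℝ} (hc : ∀ n, ‖c n‖ ≤ M) :
    Differentiable ℂ (synthHol γ c) := by
  have hτ := tau_im hγ
  have key : Differentiable ℂ fun z : ℂ => ∑' n, c n * jacobiTheta₂_term n z (tau γ) := by
    intro z₀
    set S := |z₀.im| + 1
    set U : Set ℂ := {z | |z.im| < S}
    have hU : IsOpen U := isOpen_lt (by fun_prop) continuous_const
    have hs := ((summable_pow_mul_jacobiTheta₂_term_bound S hτ 0).mul_left M)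
    refine (Complex.differentiableOn_tsum_of_summable_norm hs (fun n => ?_) hU
      fun n z hz => ?_).differentiableAt (hU.mem_nhds (by simp [U, S]))
    · have : Differentiable ℂ fun z : ℂ => c n * jacobiTheta₂_term n z (tau γ) := by
        unfold jacobiTheta₂_term
        fun_prop
      exact this.differentiableOn
    · rw [norm_mul, pow_zero, one_mul]
      have hM : 0 ≤ M := (norm_nonneg _).trans (hc 0)
      exact mul_le_mul (hc n) (norm_jacobiTheta₂_term_le hτ (le_of_lt hz) le_rfl n)
        (norm_nonneg _) hM
  have h2 : Differentiable ℂ fun z : ℂ => ∑' n, c n * jacobiTheta₂_term n (z / γ) (tau γ) :=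
    key.comp (differentiable_id.div_const (γ : ℂ))
  unfold synthHol
  fun_prop

lemma continuous_synth {γ : ℝ} (hγ : 0 < γ) {c : ℤ → ℂ} {M : ℝ} (hc : ∀ n, ‖c n‖ ≤ M) :
    Continuous (synth γ c) := by
  have h := (differentiable_synthHol hγ hc).continuous
  have : synth γ c = fun z => Complex.exp (-((‖z‖ ^ 2 : ℝ) : ℂ) / 2) * synthHol γ c z :=
    funext (synth_eq_synthHol γ c)
  rw [this]
  fun_prop

lemma continuous_psi (γ : ℝ) (n : ℤ) : Continuous (psi γ n) := by
  have : psi γ n = fun z => Complex.exp (-((‖z‖ ^ 2 : ℝ) : ℂ) / 2) *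
      (nrm γ * Complex.exp (z ^ 2 / 2) * jacobiTheta₂_term n (z / γ) (tau γ)) :=
    funext (psi_eq_term γ n)
  rw [this]
  unfold jacobiTheta₂_term
  fun_prop

lemma magTrans_psi {γ : ℝ} (hγ : 0 < γ) (n : ℤ) (z : ℂ) :
    magTrans (γ : ℂ) (psi γ n) z = psi γ n z := by
  rw [magTrans]
  conv_rhs => rw [← Complex.re_add_im z]
  have e : z + (γ : ℂ) = ((z.re + γ : ℝ) : ℂ) + (z.im : ℂ) * Complex.I := by
    conv_lhs => rw [← Complex.re_add_im z]
    push_cast; ring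
  have e2 : (z.re + γ) / γ = z.re / γ + 1 := by field_simp
  rw [e, psi_coord, psi_coord, e2, fmode_periodic, ← mul_assoc, ← Complex.exp_add]
  congr 2
  apply Complex.ext <;> (simp; try ring)

lemma inFgamma_synth {γ : ℝ} (hγ : 0 < γ) {c : ℤ → ℂ} {M : ℝ} (hc : ∀ n, ‖c n‖ ≤ M) :
    InFgamma γ (synth γ c) := by
  obtain ⟨C, hC⟩ := exists_norm_synth_le hγ hc
  refine ⟨⟨⟨synthHol γ c, differentiable_synthHol hγ hc, synth_eq_synthHol γ c⟩, 0, C, ?_⟩, ?_⟩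
  · simpa using hC
  · funext z
    rw [magTrans, synth, synth, ← tsum_mul_left]
    refine tsum_congr fun n => ?_
    rw [mul_left_comm]
    congr 1
    exact magTrans_psi hγ n z

/-- The constant `K` such that `Φ₀ = K ∑ ψ_n`. -/
def phiCoef (γ : ℝ) : ℝ := Real.exp (Real.pi ^ 2 / (4 * γ ^ 2)) / nrm γ

lemma Phi0_eq_synth {γ : ℝ} (hγ : 0 < γ) : Phi0 γ = synth γ fun _ => (phiCoef γ : ℂ) := by
  have hγ' : (γ : ℂ) ≠ 0 := by exact_mod_cast hγ.ne'
  have hN : (nrm γ : ℂ) ≠ 0 := by exact_mod_cast (nrm_pos hγ).ne'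
  funext z
  rw [synth_eq_synthHol, synthHol, Phi0, Theta]
  simp only [← tsum_mul_left]
  refine tsum_congr fun n => ?_
  have e1 : (-1 : ℂ) ^ n = Complex.exp (Real.pi * Complex.I * n) := by
    rw [mul_comm _ (n : ℂ), Complex.exp_int_mul, Complex.exp_pi_mul_I]
  have e2 : -Complex.I = Complex.exp (-(Real.pi / 2 * Complex.I)) := by
    rw [Complex.exp_neg, Complex.exp_pi_div_two_mul_I, Complex.inv_I]
  rw [phiCoef, Complex.ofReal_div, Complex.ofReal_exp, jacobiTheta₂_term, e1, e2]
  have e3 : ∀ A B C D E : ℂ, Complex.exp A * (Complex.exp B * (Complex.exp C * Complex.exp D *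
      Complex.exp E)) = Complex.exp (A + B + C + D + E) := by
    intro A B C D E; simp only [Complex.exp_add]; ring
  have e4 : ∀ A B C D N : ℂ, N ≠ 0 → Complex.exp A * (N * Complex.exp B * (Complex.exp C / N *
      Complex.exp D)) = Complex.exp (A + B + C + D) := by
    intro A B C D N hN; simp only [Complex.exp_add]; field_simp
  -- The half-integer shift `-(τ-1)/2` makes the two exponents agree modulo `2πi n`.
  rw [e3, e4 _ _ _ _ _ hN, Complex.exp_eq_exp_iff_exists_int]
  refine ⟨n, ?_⟩
  simp only [tau]
  push_cast
  field_simp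
  ring_nf
  simp only [Complex.I_sq]
  ring

lemma norm_phiCoef_le (γ : ℝ) : ∀ _ : ℤ, ‖(phiCoef γ : ℂ)‖ ≤ |phiCoef γ| := fun _ => by simp

/-! ### Parseval's identity on the strip -/

/-- The restriction of `u` to the horizontal line of ordinate `y`, rescaled to unit period and
stripped of the magnetic phase `exp(ixy)`. -/
def lineFn (γ : ℝ) (u : ℂ → ℂ) (y s : ℝ) : ℂ :=
  Complex.exp (-(Complex.I * (γ * s : ℝ) * y)) * u ((γ * s : ℝ) + y * Complex.I)

lemma norm_lineFn (γ : ℝ) (u : ℂ → ℂ) (y s : ℝ) :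
    ‖lineFn γ u y s‖ = ‖u ((γ * s : ℝ) + y * Complex.I)‖ := by
  rw [lineFn, norm_mul, Complex.exp_neg, norm_inv, norm_exp_I_mul, inv_one, one_mul]

lemma continuous_lineFn (γ : ℝ) {u : ℂ → ℂ} (hu : Continuous u) (y : ℝ) :
    Continuous (lineFn γ u y) := by
  unfold lineFn
  fun_prop

lemma lineFn_periodic {γ : ℝ} {u : ℂ → ℂ} (hu : magTrans (γ : ℂ) u = u) (y : ℝ) :
    Function.Periodic (lineFn γ u y) 1 := by
  intro s
  have h := congrFun hu ((γ * s : ℝ) + y * Complex.I)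
  rw [lineFn, lineFn, ← h, magTrans, ← mul_assoc, ← Complex.exp_add]
  have e : (((γ * (s + 1) : ℝ) : ℂ) + y * Complex.I) = (γ * s : ℝ) + y * Complex.I + γ := by
    push_cast; ring
  rw [e]
  congr 2
  apply Complex.ext <;> (simp; try ring)

lemma memLp_of_continuous {f : ℝ → ℂ} (hf : Continuous f) : MemLp f 2 unitMeasure := by
  obtain ⟨C, hC⟩ := isCompact_Icc.exists_bound_of_continuousOn (s := Icc (0 : ℝ) 1) hf.continuousOn
  exact MemLp.of_bound hf.aestronglyMeasurable C
    ((ae_restrict_iff' measurableSet_Icc).2 (Eventually.of_forall hC))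

lemma fcoef_tsum_fmode {d : ℤ → ℂ} (hd : Summable fun n => ‖d n‖) (n : ℤ) :
    fcoef (fun s => ∑' m, d m * fmode m s) n = d n := by
  have hF : ∀ m : ℤ, Integrable (fun ξ => d m * (fmode (-n) ξ * fmode m ξ)) unitMeasure :=
    fun m => (integrable_fmode_mul (integrable_of_memLp (memLp_fmode m)) _).const_mul _
  have hS : Summable fun m : ℤ => ∫ ξ, ‖d m * (fmode (-n) ξ * fmode m ξ)‖ ∂unitMeasure := by
    refine hd.congr fun m => ?_
    simp [norm_fmode, unitMeasure]
  have h := (hasSum_integral_of_summable_integral_norm hF hS).tsum_eq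
  simp only [integral_const_mul] at h
  have e : ∀ m : ℤ, ∫ ξ, fmode (-n) ξ * fmode m ξ ∂unitMeasure = if n = m then 1 else 0 :=
    fun m => fcoef_fmode m n
  simp only [e] at h
  rw [fcoef]
  simp only [← tsum_mul_left]
  have e2 : ∀ ξ m, fmode (-n) ξ * (d m * fmode m ξ) = d m * (fmode (-n) ξ * fmode m ξ) :=
    fun ξ m => by ring
  simp only [e2]
  rw [← h, tsum_eq_single n]
  · simp
  · intro m hm
    simp [hm.symm]

/-- The Fourier coefficients on the line of ordinate `y` of the superposition with amplitudes
`c`. -/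
def lineCoef (γ : ℝ) (c : ℤ → ℂ) (y : ℝ) (n : ℤ) : ℂ :=
  c n * (nrm γ * Real.exp (-(y + beta γ n) ^ 2) : ℝ)

lemma lineFn_synth {γ : ℝ} (hγ : 0 < γ) (c : ℤ → ℂ) (y s : ℝ) :
    lineFn γ (synth γ c) y s = ∑' n, lineCoef γ c y (-n) * fmode n s := by
  rw [lineFn, synth, ← tsum_mul_left]
  have := (Equiv.neg ℤ).tsum_eq fun n => lineCoef γ c y (-n) * fmode n s
  rw [← this]
  refine tsum_congr fun n => ?_
  rw [psi_coord, Equiv.neg_apply, neg_neg, lineCoef]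
  have e : γ * s / γ = s := by field_simp
  rw [e, Complex.exp_neg, mul_left_comm, inv_mul_cancel_left₀ (Complex.exp_ne_zero _)]
  push_cast
  ring

lemma fcoef_lineFn_synth {γ : ℝ} (hγ : 0 < γ) {c : ℤ → ℂ} {M : ℝ} (hc : ∀ n, ‖c n‖ ≤ M)
    (y : ℝ) (n : ℤ) : fcoef (lineFn γ (synth γ c) y) n = lineCoef γ c y (-n) := by
  rw [funext (lineFn_synth hγ c y)]
  refine fcoef_tsum_fmode (d := fun n => lineCoef γ c y (-n)) ?_ n
  have h := summable_norm_synth hγ hc (y * Complex.I)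
  refine ((Equiv.neg ℤ).summable_iff.2 h).congr fun n => ?_
  simp only [Function.comp_apply, Equiv.neg_apply, norm_mul, norm_psi hγ, lineCoef]
  rw [Complex.norm_real, Real.norm_of_nonneg]
  · simp
  · have := nrm_pos hγ
    positivity

lemma measurableSet_strip (γ : ℝ) : MeasurableSet (strip γ) := by
  have h : IsClosed (strip γ) := (isClosed_le continuous_const Complex.continuous_re).inter
    (isClosed_le Complex.continuous_re continuous_const)
  exact h.measurableSet

lemma lintegral_strip {γ : ℝ} (hγ : 0 < γ) {F : ℂ → ENNReal} (hF : Measurable F) :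
    ∫⁻ z, F z ∂stripMeasure γ =
      ∫⁻ y : ℝ, ENNReal.ofReal γ * ∫⁻ s, F ((γ * s : ℝ) + y * Complex.I) ∂unitMeasure := by
  have hinner : ∀ y : ℝ, ENNReal.ofReal γ * ∫⁻ s, F ((γ * s : ℝ) + y * Complex.I) ∂unitMeasure =
      ∫⁻ x, F (x + y * Complex.I) ∂(volume.restrict (Icc 0 γ)) := by
    intro y
    have hm : Measurable fun x : ℝ => F ((x : ℂ) + y * Complex.I) := hF.comp (by fun_prop)
    have h1 := Real.map_volume_mul_left hγ.ne'
    have h2 : ENNReal.ofReal γ • Measure.map (γ * ·) (volume : Measure ℝ) = volume := by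
      rw [h1, smul_smul, abs_of_pos (inv_pos.2 hγ), ← ENNReal.ofReal_mul hγ.le,
        mul_inv_cancel₀ hγ.ne', ENNReal.ofReal_one, one_smul]
    conv_rhs => rw [← h2]
    rw [Measure.restrict_smul, lintegral_smul_measure, Measure.restrict_map (by fun_prop)
      measurableSet_Icc, lintegral_map hm (by fun_prop)]
    have e : (fun x => γ * x) ⁻¹' Icc 0 γ = Icc (0 : ℝ) 1 := by
      ext x
      simp only [mem_preimage, mem_Icc]
      constructor
      · rintro ⟨h3, h4⟩
        exact ⟨by by_contra h; nlinarith, by nlinarith⟩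
      · rintro ⟨h3, h4⟩
        exact ⟨by positivity, by nlinarith⟩
    rw [e]
    rfl
  simp only [hinner]
  have hmp := Complex.volume_preserving_equiv_real_prod.symm
  have hpre : Complex.measurableEquivRealProd.symm ⁻¹' strip γ = Icc 0 γ ×ˢ univ := by
    ext p
    simp [strip, Complex.measurableEquivRealProd_symm_apply]
  have h1 := (hmp.restrict_preimage (measurableSet_strip γ)).lintegral_comp hF
  rw [hpre, Measure.volume_eq_prod, ← Measure.prod_restrict, Measure.restrict_univ] at h1
  rw [stripMeasure, ← h1, lintegral_prod_symm']
  · refine lintegral_congr fun y => lintegral_congr fun x => ?_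
    congr 1
    rw [Complex.measurableEquivRealProd_symm_apply]
    apply Complex.ext <;> simp
  · exact hF.comp Complex.measurableEquivRealProd.symm.measurable

lemma lintegral_gaussian_line {γ : ℝ} (hγ : 0 < γ) (b : ℝ) :
    ∫⁻ y : ℝ, ENNReal.ofReal (γ * (nrm γ * Real.exp (-(y + b) ^ 2)) ^ 2) = 1 := by
  have hπ := Real.pi_pos
  have e : ∀ y : ℝ, γ * (nrm γ * Real.exp (-(y + b) ^ 2)) ^ 2 =
      Real.sqrt (2 / Real.pi) * Real.exp (-2 * (y + b) ^ 2) := by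
    intro y
    rw [mul_pow, nrm_sq hγ, ← Real.exp_nat_mul]
    field_simp
    push_cast
    ring_nf
  have hi : Integrable fun y : ℝ => Real.exp (-2 * (y + b) ^ 2) :=
    (integrable_exp_neg_mul_sq (b := 2) (by norm_num)).comp_add_right b
  simp only [e]
  rw [← ofReal_integral_eq_lintegral_ofReal (hi.const_mul _)
    (Eventually.of_forall fun y => by positivity), integral_const_mul,
    integral_add_right_eq_self (fun y : ℝ => Real.exp (-2 * y ^ 2)) b, integral_gaussian,
    ← Real.sqrt_mul (by positivity)]
  have : 2 / Real.pi * (Real.pi / 2) = 1 := by field_simp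
  simp [this]

/-- Parseval's identity on the strip: on each horizontal line it is Parseval's identity for Fourier
series, and the Gaussian weights have mass one in the vertical direction. -/
lemma eLpNorm_sq_strip_eq {γ : ℝ} (hγ : 0 < γ) {u : ℂ → ℂ} (hu : Continuous u) {c : ℤ → ℂ}
    (h : ∀ y n, fcoef (lineFn γ u y) n = lineCoef γ c y (-n)) :
    eLpNorm u 2 (stripMeasure γ) ^ 2 = sqNorm c := by
  have h0 := nrm_pos hγ
  rw [eLpNorm_two_sq, lintegral_strip hγ (by fun_prop)]
  have e : ∀ y : ℝ, ENNReal.ofReal γ * ∫⁻ s, ‖u ((γ * s : ℝ) + y * Complex.I)‖ₑ ^ 2 ∂unitMeasure =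
      ∑' n, ‖c n‖ₑ ^ 2 *
        ENNReal.ofReal (γ * (nrm γ * Real.exp (-(y + beta γ n) ^ 2)) ^ 2) := by
    intro y
    have h1 := eLpNorm_sq_eq_sqNorm_fcoef (memLp_of_continuous (continuous_lineFn γ hu y))
    rw [eLpNorm_two_sq, funext (h y), sqNorm_neg_index] at h1
    have h2 : ∀ s, ‖lineFn γ u y s‖ₑ = ‖u ((γ * s : ℝ) + y * Complex.I)‖ₑ := fun s => by
      rw [← ofReal_norm, norm_lineFn, ofReal_norm]
    simp only [h2] at h1
    rw [h1, sqNorm, ← ENNReal.tsum_mul_left]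
    refine tsum_congr fun n => ?_
    rw [lineCoef, enorm_mul, mul_pow, mul_left_comm]
    congr 1
    rw [ENNReal.ofReal_mul hγ.le, ENNReal.ofReal_pow (by positivity)]
    congr 2
    rw [← ofReal_norm, Complex.norm_real, Real.norm_of_nonneg (by positivity)]
  simp only [e]
  rw [lintegral_tsum]
  · rw [sqNorm]
    refine tsum_congr fun n => ?_
    rw [lintegral_const_mul' _ _ (by simp), lintegral_gaussian_line hγ, mul_one]
  · intro n
    refine Measurable.aemeasurable ?_
    fun_prop

lemma eLpNorm_sq_synth {γ : ℝ} (hγ : 0 < γ) {c : ℤ → ℂ} {M : ℝ} (hc : ∀ n, ‖c n‖ ≤ M) :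
    eLpNorm (synth γ c) 2 (stripMeasure γ) ^ 2 = sqNorm c :=
  eLpNorm_sq_strip_eq hγ (continuous_synth hγ hc) fun y n => fcoef_lineFn_synth hγ hc y n

lemma InX_synth {γ : ℝ} (hγ : 0 < γ) {c : ℤ → ℂ} (hc : sqNorm c ≠ ⊤) : InX γ (synth γ c) := by
  obtain ⟨M, hM⟩ := exists_norm_le_of_sqNorm hc
  refine ⟨inFgamma_synth hγ hM, (continuous_synth hγ hM).aestronglyMeasurable, ?_⟩
  have h := eLpNorm_sq_synth hγ hM
  by_contra htop
  rw [not_lt_top_iff] at htop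
  rw [htop] at h
  exact hc (by simpa using h.symm)

/-! ### Expansion of an element of `L²(S_γ) ∩ F_γ` -/

/-- The integral over a period of a periodic entire function does not depend on the height. -/
lemma integral_period_eq {γ : ℝ} {G : ℂ → ℂ} (hG : Differentiable ℂ G)
    (hper : ∀ z, G (z + γ) = G z) (y : ℝ) :
    ∫ x in (0 : ℝ)..γ, G (x + y * Complex.I) = ∫ x in (0 : ℝ)..γ, G x := by
  have h := Complex.integral_boundary_rect_eq_zero_of_differentiableOn G 0 (γ + y * Complex.I)
    hG.differentiableOn
  have e : ∀ t : ℝ, G ((γ : ℂ) + t * Complex.I) = G (t * Complex.I) := by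
    intro t; rw [add_comm, hper]
  simp [e] at h
  linear_combination -h

/-- The Fourier coefficients of `u` on the line of ordinate `y` depend on `y` only through an explicit
Gaussian, because `exp(-z²/2)` times the entire factor of `u` is `γ`-periodic and entire. -/
lemma exists_lineCoef {γ : ℝ} (hγ : 0 < γ) {u : ℂ → ℂ} (hu : InFgamma γ u) :
    Continuous u ∧ ∃ c : ℤ → ℂ, ∀ y n, fcoef (lineFn γ u y) n = lineCoef γ c y (-n) := by
  obtain ⟨⟨⟨f, hf, huf⟩, -⟩, hper⟩ := hu
  have hγ' : (γ : ℂ) ≠ 0 := by exact_mod_cast hγ.ne'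
  have hN : (nrm γ : ℂ) ≠ 0 := by exact_mod_cast (nrm_pos hγ).ne'
  have hcont : Continuous u := by
    have := hf.continuous
    rw [funext huf]
    fun_prop
  refine ⟨hcont, ?_⟩
  have hgper : ∀ z : ℂ, f (z + γ) * Complex.exp (-((z + γ) ^ 2 / 2)) =
      f z * Complex.exp (-(z ^ 2 / 2)) := by
    intro z
    have h1 := congrFun hper z
    rw [magTrans, huf, huf, ← mul_assoc, ← Complex.exp_add] at h1
    have e : (γ * conj z - conj (γ : ℂ) * z) / 2 + -((‖z + γ‖ ^ 2 : ℝ) : ℂ) / 2 =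
        -((‖z‖ ^ 2 : ℝ) : ℂ) / 2 + (z ^ 2 / 2 + -((z + γ) ^ 2 / 2)) := by
      rw [norm_sq_re_im, norm_sq_re_im]
      apply Complex.ext <;> (simp [sq]; try ring)
    rw [e, Complex.exp_add, mul_assoc, mul_right_inj' (Complex.exp_ne_zero _),
      Complex.exp_add] at h1
    rw [Complex.exp_neg (z ^ 2 / 2)]
    have h2 := Complex.exp_ne_zero (z ^ 2 / 2 : ℂ)
    field_simp
    linear_combination h1
  -- Multiplying by the dual exponential turns a Fourier coefficient into a period integral.
  set G : ℤ → ℂ → ℂ := fun n z => f z * Complex.exp (-(z ^ 2 / 2)) *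
    Complex.exp (2 * Real.pi * Complex.I * n * (z / γ)) with hG
  have hGd : ∀ n, Differentiable ℂ (G n) := by
    intro n
    simp only [hG]
    fun_prop
  have hGper : ∀ n z, G n (z + γ) = G n z := by
    intro n z
    simp only [hG]
    rw [hgper]
    congr 1
    rw [Complex.exp_eq_exp_iff_exists_int]
    refine ⟨n, ?_⟩
    field_simp
  set J : ℤ → ℂ := fun n => ∫ x in (0 : ℝ)..γ, G n x with hJ
  refine ⟨fun m => γ⁻¹ * J (-m) * Real.exp (beta γ m ^ 2) / nrm γ, fun y n => ?_⟩
  rw [lineCoef, fcoef, integral_unitMeasure]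
  simp only [neg_neg]
  have e1 : ∀ s : ℝ, fmode (-n) s * lineFn γ u y s =
      (Real.exp (-(y + beta γ (-n)) ^ 2 + beta γ (-n) ^ 2) : ℝ) *
        G n ((γ * s : ℝ) + y * Complex.I) := by
    intro s
    simp only [hG, lineFn, huf, fmode]
    have e3 : ∀ A B C D E F X : ℂ, A + B + C = D + (E + F) →
        Complex.exp A * (Complex.exp B * (Complex.exp C * X)) =
        Complex.exp D * (X * Complex.exp E * Complex.exp F) := by
      intro A B C D E F X h
      calc _ = Complex.exp (A + B + C) * X := by simp only [Complex.exp_add]; ring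
        _ = _ := by rw [h]; simp only [Complex.exp_add]; ring
    rw [Complex.ofReal_exp]
    refine e3 _ _ _ _ _ _ _ ?_
    have eb : beta γ (-n) = -(n * Real.pi / γ) := by simp only [beta]; push_cast; ring
    rw [norm_sq_re_im, eb]
    simp only [Complex.add_re, Complex.ofReal_re, Complex.mul_re, Complex.I_re, Complex.I_im,
      Complex.ofReal_im, Complex.add_im, Complex.mul_im]
    push_cast
    field_simp
    ring_nf
    simp only [Complex.I_sq]
    ring
  simp only [e1]
  rw [intervalIntegral.integral_const_mul]
  have e2 := intervalIntegral.integral_comp_mul_left (a := 0) (b := 1)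
    (fun x : ℝ => G n ((x : ℂ) + y * Complex.I)) hγ.ne'
  rw [e2, mul_zero, mul_one, integral_period_eq (hGd n) (hGper n), Real.exp_add, Complex.real_smul]
  simp only [hJ]
  push_cast
  field_simp

/-- A continuous 1-periodic function is determined by its Fourier coefficients. -/
lemma eq_of_fcoef_eq {f g : ℝ → ℂ} (hf : Continuous f) (hg : Continuous g)
    (hfp : Function.Periodic f 1) (hgp : Function.Periodic g 1) (h : fcoef f = fcoef g) : f = g := by
  have hf2 := memLp_of_continuous hf
  have hg2 := memLp_of_continuous hg
  have hd := (hasDFT_iff.2 ⟨hfp, hf2, rfl⟩).sub (hasDFT_iff.2 ⟨hgp, hg2, h.symm⟩)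
  have h1 := hd.eLpNorm_sq
  have h2 : eLpNorm (fun ξ => f ξ - g ξ) 2 unitMeasure = 0 := by
    simpa [sqNorm] using h1
  rw [eLpNorm_eq_zero_iff hd.2.1.1 (by norm_num)] at h2
  have h3 : f =ᵐ[volume.restrict (Icc 0 1)] g := by
    filter_upwards [h2] with x hx
    simpa [sub_eq_zero] using hx
  have h4 := Measure.eqOn_Icc_of_ae_eq volume zero_ne_one h3 hf.continuousOn hg.continuousOn
  funext x
  have h5 := h4 (x := Int.fract x) ⟨Int.fract_nonneg x, (Int.fract_lt_one x).le⟩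
  have h6 := hfp.sub_int_mul_eq (x := x) ⌊x⌋
  have h7 := hgp.sub_int_mul_eq (x := x) ⌊x⌋
  rw [mul_one] at h6 h7
  rw [← h6, ← h7]
  exact h5

/-- Every element of `L²(S_γ) ∩ F_γ` is a superposition of the `ψ_n` with square-summable
amplitudes. -/
lemma exists_eq_synth {γ : ℝ} (hγ : 0 < γ) {u : ℂ → ℂ} (hu : InX γ u) :
    ∃ c, sqNorm c ≠ ⊤ ∧ u = synth γ c := by
  obtain ⟨hcont, c, hc⟩ := exists_lineCoef hγ hu.1
  have h1 := eLpNorm_sq_strip_eq hγ hcont hc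
  have hfin : sqNorm c ≠ ⊤ := by
    rw [← h1]
    exact ENNReal.pow_ne_top hu.2.2.ne
  refine ⟨c, hfin, ?_⟩
  obtain ⟨M, hM⟩ := exists_norm_le_of_sqNorm hfin
  have hline : ∀ y, lineFn γ u y = lineFn γ (synth γ c) y := fun y =>
    eq_of_fcoef_eq (continuous_lineFn γ hcont y) (continuous_lineFn γ (continuous_synth hγ hM) y)
      (lineFn_periodic hu.1.2 y) (lineFn_periodic (inFgamma_synth hγ hM).2 y)
      (funext fun n => by rw [hc, fcoef_lineFn_synth hγ hM])
  funext z
  have h2 := congrFun (hline z.im) (z.re / γ)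
  have e : γ * (z.re / γ) = z.re := by field_simp
  rw [lineFn, lineFn, e, Complex.re_add_im, mul_right_inj' (Complex.exp_ne_zero _)] at h2
  exact h2

lemma synth_sub_sum {γ : ℝ} (hγ : 0 < γ) {a : ℤ → ℂ} {M : ℝ} (ha : ∀ n, ‖a n‖ ≤ M) (c : ℤ → ℂ)
    (s : Finset ℤ) (z : ℂ) : synth γ a z - ∑ n ∈ s, c n * psi γ n z =
      synth γ (fun n => a n - if n ∈ s then c n else 0) z := by
  have h1 := hasSum_synth hγ ha z
  have h2 : HasSum (fun n => (if n ∈ s then c n else 0) * psi γ n z)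
      (∑ n ∈ s, c n * psi γ n z) := by
    have : ∑ n ∈ s, c n * psi γ n z = ∑ n ∈ s, (if n ∈ s then c n else 0) * psi γ n z :=
      Finset.sum_congr rfl fun n hn => by simp [hn]
    rw [this]
    exact hasSum_sum_of_ne_finset_zero fun n hn => by simp [hn]
  rw [← (h1.sub h2).tsum_eq, synth]
  exact tsum_congr fun n => by ring

lemma exists_bound_sub_truncation {a : ℤ → ℂ} {M : ℝ} (ha : ∀ n, ‖a n‖ ≤ M) (c : ℤ → ℂ)
    (s : Finset ℤ) : ∀ n, ‖a n - if n ∈ s then c n else 0‖ ≤ M + ∑ m ∈ s, ‖c m‖ := by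
  intro n
  refine (norm_sub_le _ _).trans (add_le_add (ha n) ?_)
  split_ifs with h
  · exact Finset.single_le_sum (f := fun m => ‖c m‖) (fun m _ => norm_nonneg _) h
  · rw [norm_zero]
    exact Finset.sum_nonneg fun m _ => norm_nonneg _

/-- The `L²` expansion of a superposition has exactly its own amplitudes. -/
lemma hasPsiExpansion_synth_iff {γ : ℝ} (hγ : 0 < γ) {a c : ℤ → ℂ} (ha : sqNorm a ≠ ⊤) :
    HasPsiExpansion γ (synth γ a) c ↔ a = c := by
  obtain ⟨M, hM⟩ := exists_norm_le_of_sqNorm ha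
  rw [← tendsto_sqNorm_truncation_iff ha, HasPsiExpansion, tendsto_zero_iff_sq]
  refine tendsto_congr fun s => ?_
  rw [← eLpNorm_sq_synth hγ (exists_bound_sub_truncation hM c s)]
  simp only [synth_sub_sum hγ hM]

lemma eq_synth_of_hasPsiExpansion {γ : ℝ} (hγ : 0 < γ) {u : ℂ → ℂ} {c : ℤ → ℂ} (hu : InX γ u)
    (h : HasPsiExpansion γ u c) : sqNorm c ≠ ⊤ ∧ u = synth γ c := by
  obtain ⟨a, ha, rfl⟩ := exists_eq_synth hγ hu
  rw [hasPsiExpansion_synth_iff hγ ha] at h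
  subst h
  exact ⟨ha, rfl⟩

lemma existsUnique_expansion {γ : ℝ} (hγ : 0 < γ) {u : ℂ → ℂ} (hu : InX γ u) :
    ∃! c : ℤ → ℂ, HasPsiExpansion γ u c ∧ ∃ f : ℝ → ℂ, HasDFT f c := by
  obtain ⟨c, hc, rfl⟩ := exists_eq_synth hγ hu
  exact ⟨c, ⟨(hasPsiExpansion_synth_iff hγ hc).2 rfl, exists_hasDFT hc⟩, fun d hd =>
    ((hasPsiExpansion_synth_iff hγ hc).1 hd.1).symm⟩

/-! ### The projector on cubic expressions in the modes -/

/-- The exponential kernel of the projector, without its prefactor. -/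
def kern (z w : ℂ) : ℂ := Complex.exp (conj w * z - ((‖w‖ ^ 2 : ℝ) : ℂ) / 2)

lemma integrable_complex_iff {F : ℂ → ℂ} :
    Integrable F ↔ Integrable (fun p : ℝ × ℝ => F (p.1 + p.2 * Complex.I)) := by
  have hmp := Complex.volume_preserving_equiv_real_prod.symm
  have h := hmp.integrable_comp_emb Complex.measurableEquivRealProd.symm.measurableEmbedding (g := F)
  rw [← h]
  refine integrable_congr (Eventually.of_forall fun p => ?_)
  simp only [Function.comp_apply, Complex.measurableEquivRealProd_symm_apply]
  congr 1
  apply Complex.ext <;> simp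

lemma integral_complex {F : ℂ → ℂ} (hF : Integrable F) :
    ∫ w, F w = ∫ y : ℝ, ∫ x : ℝ, F (x + y * Complex.I) := by
  have hmp := Complex.volume_preserving_equiv_real_prod.symm
  rw [← hmp.integral_comp Complex.measurableEquivRealProd.symm.measurableEmbedding,
    Measure.volume_eq_prod]
  have e : ∀ p : ℝ × ℝ, F (Complex.measurableEquivRealProd.symm p) =
      F (p.1 + p.2 * Complex.I) := by
    intro p
    rw [Complex.measurableEquivRealProd_symm_apply]
    congr 1
    apply Complex.ext <;> simp
  simp only [e]
  rw [integral_prod_symm]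
  have := integrable_complex_iff.1 hF
  rwa [Measure.volume_eq_prod] at this

lemma integrable_kern (z : ℂ) : Integrable (kern z) := by
  rw [integrable_complex_iff, Measure.volume_eq_prod]
  have h1 := integrable_cexp_quadratic (b := 1 / 2) (by norm_num) z 0
  have h2 := integrable_cexp_quadratic (b := 1 / 2) (by norm_num) (-Complex.I * z) 0
  refine (h1.mul_prod h2).congr (Eventually.of_forall fun p => ?_)
  simp only [kern, ← Complex.exp_add]
  congr 1
  rw [norm_sq_re_im]
  apply Complex.ext <;> (simp [sq]; try ring)

lemma psi_cubic_coord (γ : ℝ) (m k n : ℤ) (x y : ℝ) :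
    psi γ m (x + y * Complex.I) * conj (psi γ k (x + y * Complex.I)) *
      psi γ n (x + y * Complex.I) = nrm γ ^ 3 * Complex.exp (Complex.I * x * y +
        2 * Complex.I * beta γ (m + n - k) * x -
        ((y + beta γ m) ^ 2 + (y + beta γ k) ^ 2 + (y + beta γ n) ^ 2)) := by
  have hf : ∀ j : ℤ, fmode j (x / γ) = Complex.exp (-(2 * Complex.I * beta γ j * x)) := by
    intro j
    simp only [fmode, beta]
    congr 1
    push_cast
    ring
  have hc : conj (Complex.exp (Complex.I * x * y)) = Complex.exp (-(Complex.I * x * y)) := by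
    rw [← Complex.exp_conj]; congr 1; simp
  have hb : ∀ j, beta γ (-j) = -beta γ j := fun j => by simp only [beta]; push_cast; ring
  rw [psi_coord, psi_coord, psi_coord, map_mul, map_mul, map_mul, conj_fmode, neg_neg,
    Complex.conj_ofReal, Complex.conj_ofReal, hc, hf, hf, hf, Complex.ofReal_exp,
    Complex.ofReal_exp, Complex.ofReal_exp, hb, hb, beta_sub, beta_add]
  have e : ∀ N A B C A' B' C' A'' B'' C'' : ℂ,
      Complex.exp A * (N * Complex.exp B * Complex.exp C) *
      (Complex.exp A' * (N * Complex.exp B' * Complex.exp C')) *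
      (Complex.exp A'' * (N * Complex.exp B'' * Complex.exp C'')) =
      N ^ 3 * Complex.exp (A + B + C + A' + B' + C' + A'' + B'' + C'') := by
    intros
    simp only [Complex.exp_add]
    ring
  rw [e]
  congr 2
  push_cast
  ring

lemma norm_psi_le {γ : ℝ} (hγ : 0 < γ) (n : ℤ) (z : ℂ) : ‖psi γ n z‖ ≤ nrm γ := by
  rw [norm_psi hγ]
  exact mul_le_of_le_one_right (nrm_pos hγ).le (Real.exp_le_one_iff.2 (by
    have := sq_nonneg (z.im + beta γ n); linarith))

lemma integrable_kern_mul {F : ℂ → ℂ} (hF : Continuous F) {C : ℝ} (hC : ∀ w, ‖F w‖ ≤ C) (z : ℂ) :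
    Integrable fun w => kern z w * F w := by
  have := (integrable_kern z).bdd_mul (c := C) hF.aestronglyMeasurable (Eventually.of_forall hC)
  simpa only [mul_comm] using this

lemma integrable_kern_mul_cubic {γ : ℝ} (hγ : 0 < γ) (m k n : ℤ) (z : ℂ) :
    Integrable fun w => kern z w * (psi γ m w * conj (psi γ k w) * psi γ n w) := by
  have hc : Continuous fun w => psi γ m w * conj (psi γ k w) * psi γ n w :=
    ((continuous_psi γ m).mul (Complex.continuous_conj.comp (continuous_psi γ k))).mul
      (continuous_psi γ n)
  refine integrable_kern_mul hc (C := nrm γ * nrm γ * nrm γ) (fun w => ?_) z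
  have := nrm_pos hγ
  rw [norm_mul, norm_mul, RCLike.norm_conj]
  gcongr <;> exact norm_psi_le hγ _ _

lemma bargmannProj_eq (u : ℂ → ℂ) (z : ℂ) : bargmannProj u z =
    (1 / (Real.pi : ℂ)) * Complex.exp (-((‖z‖ ^ 2 : ℝ) : ℂ) / 2) * ∫ w : ℂ, kern z w * u w := rfl

/-- The coefficient of `ψ_{m+n-k}` in `Π(ψ_m conj(ψ_k) ψ_n)`. -/
def cubicCoef (γ : ℝ) (i j : ℤ) : ℝ := nrm γ ^ 2 / Real.sqrt 2 * (theta γ i * theta γ j)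

/-- Integrating first in `x` and then in `y` reduces the projection of a cubic product of modes to
two Gaussian integrals. -/
lemma bargmannProj_cubic {γ : ℝ} (hγ : 0 < γ) (m k n : ℤ) (z : ℂ) :
    bargmannProj (fun w => psi γ m w * conj (psi γ k w) * psi γ n w) z =
      cubicCoef γ (m - k) (n - k) * psi γ (m + n - k) z := by
  have hπ := Real.pi_pos
  rw [bargmannProj_eq, integral_complex (integrable_kern_mul_cubic hγ m k n z)]
  simp only [psi_cubic_coord]
  set p := beta γ (m + n - k) with hp
  set bm := beta γ m with hbm
  set bk := beta γ k with hbk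
  set bn := beta γ n with hbn
  have hpe : p = bm + bn - bk := by rw [hp, beta_sub, beta_add]
  have e1 : ∀ x y : ℝ, kern z (x + y * Complex.I) * (nrm γ ^ 3 * Complex.exp (Complex.I * x * y +
        2 * Complex.I * p * x - ((y + bm) ^ 2 + (y + bk) ^ 2 + (y + bn) ^ 2))) =
      nrm γ ^ 3 * Complex.exp ((-1 / 2 : ℂ) * x ^ 2 + (z + Complex.I * y + 2 * Complex.I * p) * x +
        (-Complex.I * y * z - y ^ 2 / 2 - ((y + bm) ^ 2 + (y + bk) ^ 2 + (y + bn) ^ 2))) := by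
    intro x y
    rw [mul_left_comm, kern, ← Complex.exp_add]
    congr 2
    rw [norm_sq_re_im]
    have : conj ((x : ℂ) + y * Complex.I) = x - y * Complex.I := by
      apply Complex.ext <;> simp
    rw [this]
    simp only [Complex.add_re, Complex.ofReal_re, Complex.mul_re, Complex.I_re, Complex.I_im,
      Complex.ofReal_im, Complex.add_im, Complex.mul_im]
    push_cast
    ring
  simp only [e1]
  -- The Gaussian integral in `x`; the result is again a Gaussian in `y`, of variance `1/8`.
  have e2 : ∀ y : ℝ, ∫ x : ℝ, (nrm γ : ℂ) ^ 3 * Complex.exp ((-1 / 2 : ℂ) * x ^ 2 +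
        (z + Complex.I * y + 2 * Complex.I * p) * x +
        (-Complex.I * y * z - y ^ 2 / 2 - ((y + bm) ^ 2 + (y + bk) ^ 2 + (y + bn) ^ 2))) =
      (nrm γ ^ 3 * (Real.pi / -(-1 / 2 : ℂ)) ^ (1 / 2 : ℂ)) *
        Complex.exp ((-4 : ℂ) * y ^ 2 + (-4 * (bm + bn)) * y +
        ((z + 2 * Complex.I * p) ^ 2 / 2 - (bm ^ 2 + bk ^ 2 + bn ^ 2))) := by
    intro y
    rw [integral_const_mul, integral_cexp_quadratic (by norm_num), ← mul_assoc]
    congr 2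
    rw [hpe]
    push_cast
    ring_nf
    simp only [Complex.I_sq]
    ring
  simp only [e2]
  rw [integral_const_mul, integral_cexp_quadratic (by norm_num)]
  have c1 : (Real.pi / -(-1 / 2 : ℂ)) ^ (1 / 2 : ℂ) = ((Real.sqrt 2 * Real.sqrt Real.pi : ℝ) : ℂ) := by
    rw [← Real.sqrt_mul (by norm_num), Real.sqrt_eq_rpow, Complex.ofReal_cpow (by positivity)]
    congr 1
    · push_cast; ring
    · push_cast; ring
  have c2 : (Real.pi / -(-4 : ℂ)) ^ (1 / 2 : ℂ) = ((Real.sqrt Real.pi / 2 : ℝ) : ℂ) := by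
    have : Real.sqrt Real.pi / 2 = Real.sqrt (Real.pi / 4) := by
      rw [Real.sqrt_div hπ.le, show (4 : ℝ) = 2 ^ 2 by norm_num, Real.sqrt_sq (by norm_num)]
    rw [this, Real.sqrt_eq_rpow, Complex.ofReal_cpow (by positivity)]
    congr 1
    · push_cast; ring
    · push_cast; ring
  rw [c1, c2, psi_eq_term, jacobiTheta₂_term_tau, cubicCoef, theta_eq_exp_beta, theta_eq_exp_beta,
    theta_eq_exp_beta, beta_sub, beta_sub, ← hp, ← hbm, ← hbn, ← hbk]
  have e3 : 2 * Real.pi * Complex.I * ((m + n - k : ℤ) : ℂ) * (z / γ) = 2 * Complex.I * p * z := by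
    rw [hp]; simp only [beta]; push_cast; ring
  rw [e3]
  have c3 : ((Real.sqrt 2 * Real.sqrt Real.pi : ℝ) : ℂ) * ((Real.sqrt Real.pi / 2 : ℝ) : ℂ) =
      Real.pi * (1 / Real.sqrt 2 : ℝ) := by
    rw [← Complex.ofReal_mul, ← Complex.ofReal_mul]
    congr 1
    have h1 := Real.mul_self_sqrt hπ.le
    have h2 := Real.mul_self_sqrt (show (0 : ℝ) ≤ 2 by norm_num)
    have h3 : Real.sqrt 2 ≠ 0 := by positivity
    field_simp
    nlinarith
  have e4 : ∀ (q0 N r s t A B : ℂ), q0 ≠ 0 → r * s = q0 * t →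
      1 / q0 * Complex.exp A * (N ^ 3 * r * (s * Complex.exp B)) =
      N ^ 3 * t * Complex.exp (A + B) := by
    intro q0 N r s t A B hq h
    rw [Complex.exp_add]
    field_simp
    linear_combination N ^ 3 * h
  rw [e4 _ _ _ _ _ _ _ (by exact_mod_cast hπ.ne') c3]
  have e5 : ∀ (N s A B C D E F : ℂ), (N ^ 2 / s * (Complex.exp A * Complex.exp B)) *
      (Complex.exp C * (N * Complex.exp D * (Complex.exp E * Complex.exp F))) =
      N ^ 3 * (1 / s) * Complex.exp (A + B + C + D + E + F) := by
    intros
    simp only [Complex.exp_add]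
    ring
  push_cast
  rw [e5]
  congr 2
  rw [hpe]
  push_cast
  ring_nf
  simp only [Complex.I_sq]
  ring

/-- Cauchy product of three absolutely convergent series. -/
lemma triple_product {f g h : ℤ → ℂ} (hf : Summable fun n => ‖f n‖) (hg : Summable fun n => ‖g n‖)
    (hh : Summable fun n => ‖h n‖) :
    (Summable fun q : ℤ × ℤ × ℤ => ‖f q.1 * (g q.2.1 * h q.2.2)‖) ∧
    ∑' q : ℤ × ℤ × ℤ, f q.1 * (g q.2.1 * h q.2.2) = (∑' n, f n) * ((∑' n, g n) * ∑' n, h n) ∧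
    ∑' q : ℤ × ℤ × ℤ, ‖f q.1 * (g q.2.1 * h q.2.2)‖ =
      (∑' n, ‖f n‖) * ((∑' n, ‖g n‖) * ∑' n, ‖h n‖) := by
  have h1 : Summable fun q : ℤ × ℤ => ‖g q.1 * h q.2‖ := hg.mul_norm hh
  have h1' : Summable fun q : ℤ × ℤ => ‖g q.1‖ * ‖h q.2‖ := by simpa only [norm_mul] using h1
  refine ⟨Summable.mul_norm (f := f) (g := fun q : ℤ × ℤ => g q.1 * h q.2) hf h1, ?_, ?_⟩
  · rw [tsum_mul_tsum_of_summable_norm hg hh,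
      tsum_mul_tsum_of_summable_norm (f := f) (g := fun q : ℤ × ℤ => g q.1 * h q.2) hf h1]
  · simp only [norm_mul]
    rw [tsum_mul_tsum_of_summable_norm hg.norm hh.norm, tsum_mul_tsum_of_summable_norm
      (f := fun n => ‖f n‖) (g := fun q : ℤ × ℤ => ‖g q.1‖ * ‖h q.2‖) hf.norm h1'.norm]

lemma integrable_kern_mul_product {γ : ℝ} (hγ : 0 < γ) (a b c : ℤ → ℂ) (q : ℤ × ℤ × ℤ) (z : ℂ) :
    Integrable (fun w => kern z w * (a q.1 * psi γ q.1 w *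
      (conj (b q.2.1 * psi γ q.2.1 w) * (c q.2.2 * psi γ q.2.2 w)))) ∧
    1 / (Real.pi : ℂ) * Complex.exp (-((‖z‖ ^ 2 : ℝ) : ℂ) / 2) *
      (∫ w, kern z w * (a q.1 * psi γ q.1 w *
        (conj (b q.2.1 * psi γ q.2.1 w) * (c q.2.2 * psi γ q.2.2 w)))) =
      a q.1 * conj (b q.2.1) * c q.2.2 *
      (cubicCoef γ (q.1 - q.2.1) (q.2.2 - q.2.1) * psi γ (q.1 + q.2.2 - q.2.1) z) := by
  obtain ⟨m, k, n⟩ := q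
  have e : (fun w => kern z w * (a m * psi γ m w *
      (conj (b k * psi γ k w) * (c n * psi γ n w)))) = fun w => (a m * conj (b k) * c n) *
      (kern z w * (psi γ m w * conj (psi γ k w) * psi γ n w)) := by
    funext w
    rw [map_mul]
    ring
  dsimp only
  rw [e]
  refine ⟨(integrable_kern_mul_cubic hγ _ _ _ z).const_mul _, ?_⟩
  rw [integral_const_mul, ← bargmannProj_cubic hγ, bargmannProj_eq]
  ring

/-- The projector applied to a cubic product of superpositions, expanded term by term. -/
lemma hasSum_bargmannProj {γ : ℝ} (hγ : 0 < γ) {a b c : ℤ → ℂ} {A B C : ℝ} (ha : ∀ n, ‖a n‖ ≤ A)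
    (hb : ∀ n, ‖b n‖ ≤ B) (hc : ∀ n, ‖c n‖ ≤ C) (z : ℂ) :
    HasSum (fun q : ℤ × ℤ × ℤ => a q.1 * conj (b q.2.1) * c q.2.2 *
      (cubicCoef γ (q.1 - q.2.1) (q.2.2 - q.2.1) * psi γ (q.1 + q.2.2 - q.2.1) z))
      (bargmannProj (fun w => synth γ a w * conj (synth γ b w) * synth γ c w) z) := by
  obtain ⟨A', hA0, hA⟩ := exists_tsum_norm_synth_le hγ ha
  obtain ⟨B', hB0, hB⟩ := exists_tsum_norm_synth_le hγ hb
  obtain ⟨C', hC0, hC⟩ := exists_tsum_norm_synth_le hγ hc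
  have hsb : ∀ w, Summable fun n => ‖conj (b n * psi γ n w)‖ := fun w => by
    simpa only [RCLike.norm_conj] using summable_norm_synth hγ hb w
  have htr := fun w => triple_product (summable_norm_synth hγ ha w) (hsb w)
    (summable_norm_synth hγ hc w)
  have hFi := fun q => (integrable_kern_mul_product hγ a b c q z).1
  have hFs : Summable fun q : ℤ × ℤ × ℤ => ∫ w, ‖kern z w * (a q.1 * psi γ q.1 w *
      (conj (b q.2.1 * psi γ q.2.1 w) * (c q.2.2 * psi γ q.2.2 w)))‖ := by
    -- Finite partial sums are bounded pointwise before integrating, so that the measurability of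
    -- the infinite sum is not needed.
    refine summable_of_sum_le (c := ∫ w, ‖kern z w‖ * (A' * (B' * C')))
      (fun q => integral_nonneg fun w => norm_nonneg _) fun s => ?_
    rw [← integral_finsetSum s fun q _ => (hFi q).norm]
    refine integral_mono (integrable_finsetSum s fun q _ => (hFi q).norm)
      ((integrable_kern z).norm.mul_const _) fun w => ?_
    simp only [norm_mul (kern z w), ← Finset.mul_sum]
    refine mul_le_mul_of_nonneg_left ?_ (norm_nonneg _)
    refine ((htr w).1.sum_le_tsum s fun q _ => norm_nonneg _).trans ?_
    rw [(htr w).2.2]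
    simp only [RCLike.norm_conj]
    exact mul_le_mul (hA w) (mul_le_mul (hB w) (hC w) (tsum_nonneg fun n => norm_nonneg _) hB0)
      (mul_nonneg (tsum_nonneg fun n => norm_nonneg _) (tsum_nonneg fun n => norm_nonneg _)) hA0
  have h := (hasSum_integral_of_summable_integral_norm hFi hFs).mul_left
    ((1 / (Real.pi : ℂ)) * Complex.exp (-((‖z‖ ^ 2 : ℝ) : ℂ) / 2))
  have hsum : ∀ w, ∑' q : ℤ × ℤ × ℤ, kern z w * (a q.1 * psi γ q.1 w *
      (conj (b q.2.1 * psi γ q.2.1 w) * (c q.2.2 * psi γ q.2.2 w))) =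
      kern z w * (synth γ a w * conj (synth γ b w) * synth γ c w) := by
    intro w
    rw [tsum_mul_left, (htr w).2.1, mul_assoc, synth, synth, synth, Complex.conj_tsum]
  simp only [hsum, (integrable_kern_mul_product hγ a b c _ z).2] at h
  exact h

/-! ### The stationary wave and the linearized operator in the basis `ψ_n` -/

/-- The resonant triples `(m, k, n)`, indexed by the output frequency `p = m + n - k` and by
`(i, j) = (m - k, n - k)`. -/
def resonance : ℤ × ℤ × ℤ ≃ ℤ × ℤ × ℤ where
  toFun q := (q.1 - q.2.2, q.1 - q.2.1 - q.2.2, q.1 - q.2.1)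
  invFun r := (r.1 + r.2.2 - r.2.1, r.1 - r.2.1, r.2.2 - r.2.1)
  left_inv q := by ext <;> simp; ring
  right_inv r := by ext <;> simp

/-- The cubic projection in the basis `ψ_p`, as a sum over the resonant triples. -/
lemma bargmannProj_synth {γ : ℝ} (hγ : 0 < γ) {a b c : ℤ → ℂ} {A B C : ℝ} (ha : ∀ n, ‖a n‖ ≤ A)
    (hb : ∀ n, ‖b n‖ ≤ B) (hc : ∀ n, ‖c n‖ ≤ C) (z : ℂ) :
    bargmannProj (fun w => synth γ a w * conj (synth γ b w) * synth γ c w) z =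
      synth γ (fun p => ((nrm γ ^ 2 / Real.sqrt 2 : ℝ) : ℂ) * ∑' i, ∑' j,
        (theta γ i : ℂ) * (theta γ j * (a (p - j) * conj (b (p - i - j)) * c (p - i)))) z := by
  have h := resonance.hasSum_iff.2 (hasSum_bargmannProj hγ ha hb hc z)
  rw [← h.tsum_eq, h.summable.tsum_prod, synth]
  refine tsum_congr fun p => ?_
  rw [(h.summable.prod_factor p).tsum_prod, mul_assoc, mul_comm _ (psi γ p z), mul_left_comm,
    ← tsum_mul_left, ← tsum_mul_left]
  refine tsum_congr fun i => ?_
  rw [← tsum_mul_left, ← tsum_mul_left]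
  refine tsum_congr fun j => ?_
  simp only [Function.comp_apply, resonance, Equiv.coe_fn_mk, cubicCoef]
  have e1 : p - j - (p - i - j) = i := by ring
  have e2 : p - i - (p - i - j) = j := by ring
  have e3 : p - j + (p - i) - (p - i - j) = p := by ring
  rw [e1, e2, e3]
  push_cast
  ring

lemma synth_const_mul (γ : ℝ) (a : ℂ) (c : ℤ → ℂ) (z : ℂ) :
    synth γ (fun n => a * c n) z = a * synth γ c z := by
  simp only [synth, mul_assoc, tsum_mul_left]

lemma synth_add {γ : ℝ} (hγ : 0 < γ) {c d : ℤ → ℂ} {M N : ℝ} (hc : ∀ n, ‖c n‖ ≤ M)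
    (hd : ∀ n, ‖d n‖ ≤ N) (z : ℂ) :
    synth γ (fun n => c n + d n) z = synth γ c z + synth γ d z := by
  rw [← ((hasSum_synth hγ hc z).add (hasSum_synth hγ hd z)).tsum_eq, synth]
  exact tsum_congr fun n => by ring

lemma synth_sub {γ : ℝ} (hγ : 0 < γ) {c d : ℤ → ℂ} {M N : ℝ} (hc : ∀ n, ‖c n‖ ≤ M)
    (hd : ∀ n, ‖d n‖ ≤ N) (z : ℂ) :
    synth γ (fun n => c n - d n) z = synth γ c z - synth γ d z := by
  rw [← ((hasSum_synth hγ hc z).sub (hasSum_synth hγ hd z)).tsum_eq, synth]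
  exact tsum_congr fun n => by ring

lemma phiCoef_sq_mul {γ : ℝ} (hγ : 0 < γ) :
    phiCoef γ ^ 2 * (nrm γ ^ 2 / Real.sqrt 2) = CM γ := by
  have h := (nrm_pos hγ).ne'
  rw [phiCoef, CM, div_pow, ← Real.exp_nat_mul]
  have : ((2 : ℕ) : ℝ) * (Real.pi ^ 2 / (4 * γ ^ 2)) = Real.pi ^ 2 / (2 * γ ^ 2) := by
    push_cast; field_simp; ring
  rw [this]
  field_simp

lemma phiCoef_sq_mul' {γ : ℝ} (hγ : 0 < γ) :
    ((nrm γ ^ 2 / Real.sqrt 2 : ℝ) : ℂ) * ((phiCoef γ : ℂ) * phiCoef γ) = CM γ := by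
  rw [← phiCoef_sq_mul hγ]
  push_cast
  ring

lemma tsum_theta {γ : ℝ} (hγ : 0 < γ) : ∑' i, (theta γ i : ℂ) = ell γ 0 := by
  rw [← Complex.ofReal_tsum, (hasSum_theta hγ).tsum_eq]

lemma lam_eq {γ : ℝ} (hγ : 0 < γ) : lam γ = CM γ * ell γ 0 ^ 2 := by
  rw [← (hasSum_theta hγ).tsum_eq]
  rfl

lemma norm_sq_Phi0 (γ : ℝ) (z : ℂ) :
    ((‖Phi0 γ z‖ ^ 2 : ℝ) : ℂ) = conj (Phi0 γ z) * Phi0 γ z := by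
  rw [← Complex.normSq_eq_conj_mul_self, Complex.normSq_eq_norm_sq]

lemma stationary_wave {γ : ℝ} (hγ : 0 < γ) (z : ℂ) :
    bargmannProj (fun w => ((‖Phi0 γ w‖ ^ 2 : ℝ) : ℂ) * Phi0 γ w) z =
      (lam γ : ℂ) * Phi0 γ z := by
  have h := bargmannProj_synth hγ (norm_phiCoef_le γ) (norm_phiCoef_le γ) (norm_phiCoef_le γ) z
  simp only [← Phi0_eq_synth hγ, Complex.conj_ofReal] at h
  have e : (fun w => ((‖Phi0 γ w‖ ^ 2 : ℝ) : ℂ) * Phi0 γ w) =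
      fun w => Phi0 γ w * conj (Phi0 γ w) * Phi0 γ w := by
    funext w
    rw [norm_sq_Phi0]
    ring
  rw [e, h]
  conv_rhs => rw [Phi0_eq_synth hγ]
  rw [← synth_const_mul]
  congr 1
  funext p
  simp only [tsum_mul_left, tsum_mul_right, tsum_theta hγ]
  rw [lam_eq hγ]
  have h2 := phiCoef_sq_mul' hγ
  push_cast at h2 ⊢
  linear_combination (phiCoef γ * (ell γ 0 : ℂ) ^ 2) * h2

lemma synth_proj_Phi0 {γ : ℝ} (hγ : 0 < γ) {c : ℤ → ℂ} {M : ℝ} (hc : ∀ n, ‖c n‖ ≤ M) (z : ℂ) :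
    bargmannProj (fun w => synth γ c w * conj (Phi0 γ w) * Phi0 γ w) z =
      synth γ (fun p => (CM γ * ell γ 0 : ℂ) * thetaConv γ c p) z := by
  have h := bargmannProj_synth hγ hc (norm_phiCoef_le γ) (norm_phiCoef_le γ) z
  simp only [← Phi0_eq_synth hγ, Complex.conj_ofReal] at h
  rw [h]
  congr 1
  funext p
  have e : ∀ i j : ℤ, (theta γ i : ℂ) * (theta γ j * (c (p - j) * phiCoef γ * phiCoef γ)) =
      theta γ i * ((theta γ j * c (p - j)) * (phiCoef γ * phiCoef γ)) := fun i j => by ring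
  simp only [e, tsum_mul_left, tsum_mul_right, tsum_theta hγ]
  rw [← phiCoef_sq_mul' hγ, thetaConv]
  ring

lemma Phi0_proj_conj_synth {γ : ℝ} (hγ : 0 < γ) {c : ℤ → ℂ} {M : ℝ} (hc : ∀ n, ‖c n‖ ≤ M)
    (z : ℂ) : bargmannProj (fun w => Phi0 γ w * conj (synth γ c w) * Phi0 γ w) z =
      synth γ (fun p => (CM γ : ℂ) * thetaConv γ (thetaConv γ fun n => conj (c n)) p) z := by
  have h := bargmannProj_synth hγ (norm_phiCoef_le γ) hc (norm_phiCoef_le γ) z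
  simp only [← Phi0_eq_synth hγ] at h
  rw [h]
  congr 1
  funext p
  have e : ∀ i j : ℤ, (theta γ i : ℂ) * (theta γ j *
      (phiCoef γ * conj (c (p - i - j)) * phiCoef γ)) =
      (theta γ i * (theta γ j * conj (c (p - i - j)))) * (phiCoef γ * phiCoef γ) :=
    fun i j => by ring
  simp only [e, tsum_mul_left, tsum_mul_right]
  rw [← phiCoef_sq_mul' hγ]
  simp only [thetaConv]
  ring

/-- The coefficients of `Π(2|Φ₀|²v + Φ₀² conj v)` in terms of those of `v`. -/
def linCoef (γ : ℝ) (c : ℤ → ℂ) (p : ℤ) : ℂ :=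
  2 * (CM γ * ell γ 0 * thetaConv γ c p) +
    CM γ * thetaConv γ (thetaConv γ fun n => conj (c n)) p

lemma sqNorm_thetaConv {γ : ℝ} (hγ : 0 < γ) {c : ℤ → ℂ} (hc : sqNorm c ≠ ⊤) :
    sqNorm (thetaConv γ c) ≠ ⊤ := by
  obtain ⟨f, hf⟩ := exists_hasDFT hc
  exact (hf.ell_mul hγ).sqNorm_ne_top

lemma exists_norm_const_mul_le (a : ℂ) {c : ℤ → ℂ} (hc : sqNorm c ≠ ⊤) :
    ∃ M, ∀ n, ‖a * c n‖ ≤ M := by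
  obtain ⟨M, hM⟩ := exists_norm_le_of_sqNorm hc
  refine ⟨‖a‖ * M, fun n => ?_⟩
  rw [norm_mul]
  exact mul_le_mul_of_nonneg_left (hM n) (norm_nonneg _)

lemma bargmannProj_two_mul_add {F G : ℂ → ℂ} (hF : Continuous F) (hG : Continuous G) {A B : ℝ}
    (hA : ∀ w, ‖F w‖ ≤ A) (hB : ∀ w, ‖G w‖ ≤ B) (z : ℂ) :
    bargmannProj (fun w => 2 * F w + G w) z = 2 * bargmannProj F z + bargmannProj G z := by
  simp only [bargmannProj_eq, mul_add, mul_left_comm _ (2 : ℂ)]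
  rw [integral_add ((integrable_kern_mul hF hA z).const_mul _) (integrable_kern_mul hG hB z),
    integral_const_mul]
  ring

lemma linTerm_synth {γ : ℝ} (hγ : 0 < γ) {c : ℤ → ℂ} (hc : sqNorm c ≠ ⊤) (z : ℂ) :
    linTerm γ (synth γ c) z = synth γ (linCoef γ c) z := by
  obtain ⟨M, hM⟩ := exists_norm_le_of_sqNorm hc
  obtain ⟨A, hA⟩ := exists_norm_synth_le hγ hM
  obtain ⟨B, hB⟩ := exists_norm_synth_le hγ (norm_phiCoef_le γ)
  have hcs := continuous_synth hγ hM
  have hcp := continuous_synth hγ (norm_phiCoef_le γ)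
  rw [← Phi0_eq_synth hγ] at hB hcp
  have hA0 : 0 ≤ A := (norm_nonneg _).trans (hA 0)
  have hB0 : 0 ≤ B := (norm_nonneg _).trans (hB 0)
  have e : (fun w => 2 * ((‖Phi0 γ w‖ ^ 2 : ℝ) : ℂ) * synth γ c w +
      Phi0 γ w ^ 2 * conj (synth γ c w)) =
      fun w => 2 * (synth γ c w * conj (Phi0 γ w) * Phi0 γ w) +
        Phi0 γ w * conj (synth γ c w) * Phi0 γ w := by
    funext w
    rw [norm_sq_Phi0]
    ring
  rw [linTerm, e, bargmannProj_two_mul_add (A := A * B * B) (B := B * A * B),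
    synth_proj_Phi0 hγ hM, Phi0_proj_conj_synth hγ hM]
  · have hcc : sqNorm (fun n => conj (c n)) ≠ ⊤ := by rwa [sqNorm_conj]
    obtain ⟨M1, h1⟩ := exists_norm_const_mul_le (2 * (CM γ * ell γ 0)) (sqNorm_thetaConv hγ hc)
    obtain ⟨M2, h2⟩ := exists_norm_const_mul_le (CM γ)
      (sqNorm_thetaConv hγ (sqNorm_thetaConv hγ hcc))
    rw [← synth_const_mul]
    simp only [← mul_assoc]
    rw [← synth_add hγ (by simpa only [mul_assoc] using h1) h2]
    congr 1
    funext p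
    simp only [linCoef]
    ring
  · exact (hcs.mul (Complex.continuous_conj.comp hcp)).mul hcp
  · exact (hcp.mul (Complex.continuous_conj.comp hcs)).mul hcp
  · intro w
    rw [norm_mul, norm_mul, RCLike.norm_conj]
    gcongr <;> first | exact hA w | exact hB w
  · intro w
    rw [norm_mul, norm_mul, RCLike.norm_conj]
    gcongr <;> first | exact hA w | exact hB w

/-! ### The linearized equation in Fourier variables -/

/-- The right-hand side of the evolution `∂ₜf = -i(a f + b conj f(-ξ))`. -/
def fourierRHS (γ : ℝ) (f : ℝ → ℂ) (ξ : ℝ) : ℂ :=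
  -Complex.I * (aSym γ ξ * f ξ + bSym γ ξ * conj (f (-ξ)))

/-- The right-hand side of the evolution of the amplitudes. -/
def coefRHS (γ : ℝ) (c : ℤ → ℂ) (n : ℤ) : ℂ := -Complex.I * (linCoef γ c n - lam γ * c n)

lemma hasDFT_fourierRHS {γ : ℝ} (hγ : 0 < γ) {f : ℝ → ℂ} {c : ℤ → ℂ} (h : HasDFT f c) :
    HasDFT (fourierRHS γ f) (coefRHS γ c) := by
  have h1 := ((h.ell_mul hγ).const_mul (CM γ * ell γ 0)).const_mul 2
  have h2 := ((h.conj_neg.ell_mul hγ).ell_mul hγ).const_mul (CM γ)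
  have h3 := ((h1.add h2).sub (h.const_mul (lam γ))).const_mul (-Complex.I)
  convert h3 using 1
  · funext ξ
    simp only [fourierRHS, aSym, bSym, lam_eq hγ]
    push_cast
    ring
  · rfl

/-- The equation determines the derivative, so that only one candidate is left. -/
lemma linEqAt_iff {γ : ℝ} (hγ : 0 < γ) {v : ℝ → ℂ → ℂ} {c : ℝ → ℤ → ℂ}
    (hc : ∀ t, sqNorm (c t) ≠ ⊤) (hv : ∀ t, v t = synth γ (c t)) (t : ℝ) :
    LinEqAt γ v t ↔ HasL2Deriv (stripMeasure γ) v (synth γ (coefRHS γ (c t))) t := by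
  have key : ∀ w : ℂ → ℂ, (∀ z, Complex.I * w z + (lam γ : ℂ) * v t z = linTerm γ (v t) z) ↔
      w = synth γ (coefRHS γ (c t)) := by
    intro w
    obtain ⟨M1, h1⟩ := exists_norm_const_mul_le (lam γ : ℂ) (hc t)
    obtain ⟨M2, h2⟩ : ∃ M, ∀ n, ‖linCoef γ (c t) n‖ ≤ M := by
      obtain ⟨f, hf⟩ := exists_hasDFT (hc t)
      have h4 := ((hf.ell_mul hγ).const_mul (CM γ * ell γ 0)).const_mul 2
      have h5 := ((hf.conj_neg.ell_mul hγ).ell_mul hγ).const_mul (CM γ)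
      exact exists_norm_le_of_sqNorm (h4.add h5).sqNorm_ne_top
    have e : ∀ z, synth γ (coefRHS γ (c t)) z =
        -Complex.I * (linTerm γ (v t) z - lam γ * v t z) := by
      intro z
      rw [hv, linTerm_synth hγ (hc t), ← synth_const_mul, ← synth_sub hγ h2 h1, ← synth_const_mul]
      rfl
    constructor
    · intro h
      funext z
      rw [e, ← h z]
      linear_combination (w z) * Complex.I_sq
    · rintro rfl z
      rw [e]
      linear_combination (-(linTerm γ (v t) z - lam γ * v t z)) * Complex.I_sq
  constructor
  · rintro ⟨w, h1, h2⟩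
    rwa [(key w).1 h2] at h1
  · intro h
    exact ⟨_, h, (key _).2 rfl⟩

/-- The second row of the system is the first one after conjugation and reflection in `ξ`. -/
lemma fourierEqAt_iff {γ : ℝ} {f : ℝ → ℝ → ℂ} (hf : ∀ t, Function.Periodic (f t) 1)
    (hm : ∀ t, MemLp (f t) 2 unitMeasure) {t : ℝ} (hper : Function.Periodic (fourierRHS γ (f t)) 1)
    (hmem : MemLp (fourierRHS γ (f t)) 2 unitMeasure) :
    FourierEqAt γ f t ↔ HasL2Deriv unitMeasure f (fourierRHS γ (f t)) t := by
  have ha : ∀ ξ, aSym γ (-ξ) = aSym γ ξ := fun ξ => by simp only [aSym, ell_neg]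
  have hb : ∀ ξ, bSym γ (-ξ) = bSym γ ξ := fun ξ => by simp only [bSym, ell_neg]
  constructor
  · rintro ⟨g, h1, h2⟩
    have h3 : (fun ξ => g ξ 0) = fourierRHS γ (f t) := by
      funext ξ
      have h4 := congrFun (h2 ξ) 0
      simp only [Arect, pairVec, Pi.smul_apply, smul_eq_mul, Matrix.mulVec, dotProduct,
        Fin.sum_univ_two, Matrix.of_apply, Matrix.cons_val', Matrix.cons_val_zero,
        Matrix.cons_val_one, Matrix.cons_val_fin_one] at h4
      rw [fourierRHS, ← h4]
      linear_combination (g ξ 0) * Complex.I_sq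
    rw [← h3]
    exact h1 0
  · intro h
    refine ⟨fun ξ => ![fourierRHS γ (f t) ξ, conj (fourierRHS γ (f t) (-ξ))], fun j => ?_,
      fun ξ => ?_⟩
    · fin_cases j
      · exact h
      · refine Tendsto.congr (fun r => ?_) h
        have h5 := eLpNorm_conj_neg
          (f := fun ξ => (r : ℂ)⁻¹ * (f (t + r) ξ - f t ξ) - fourierRHS γ (f t) ξ)
          (fun ξ => by simp only [hf _ ξ, hper ξ])
          (((((hm _).sub (hm _)).const_mul _).sub hmem).1)
        rw [← h5]
        congr 1
        funext ξ
        simp [pairVec]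
    · funext j
      fin_cases j
      · simp [Arect, pairVec, fourierRHS, Matrix.mulVec, dotProduct, Fin.sum_univ_two]
        linear_combination (-(aSym γ ξ * f t ξ + bSym γ ξ * conj (f t (-ξ)))) * Complex.I_sq
      · simp [Arect, pairVec, fourierRHS, Matrix.mulVec, dotProduct, Fin.sum_univ_two, ha, hb]
        linear_combination (aSym γ ξ * conj (f t (-ξ)) + bSym γ ξ * f t ξ) * Complex.I_sq

/-- Both `L²` derivatives are the `ℓ²` derivative of the amplitudes, by the two Parseval
identities. -/
lemma hasL2Deriv_strip_iff {γ : ℝ} (hγ : 0 < γ) {c : ℝ → ℤ → ℂ} {f : ℝ → ℝ → ℂ}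
    (hf : ∀ t, HasDFT (f t) (c t)) {d : ℤ → ℂ} {g : ℝ → ℂ} (hg : HasDFT g d) (t : ℝ) :
    HasL2Deriv (stripMeasure γ) (fun s => synth γ (c s)) (synth γ d) t ↔
      HasL2Deriv unitMeasure f g t := by
  unfold HasL2Deriv
  rw [tendsto_zero_iff_sq, tendsto_zero_iff_sq (F := fun h : ℝ =>
    eLpNorm (fun x => (h : ℂ)⁻¹ * (f (t + h) x - f t x) - g x) 2 unitMeasure)]
  refine tendsto_congr fun r => ?_
  have h1 := (((hf (t + r)).sub (hf t)).const_mul (r : ℂ)⁻¹).sub hg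
  rw [h1.eLpNorm_sq]
  obtain ⟨M, hM⟩ := exists_norm_le_of_sqNorm h1.sqNorm_ne_top
  rw [← eLpNorm_sq_synth hγ hM]
  obtain ⟨M1, hM1⟩ := exists_norm_le_of_sqNorm (hf (t + r)).sqNorm_ne_top
  obtain ⟨M2, hM2⟩ := exists_norm_le_of_sqNorm (hf t).sqNorm_ne_top
  obtain ⟨M3, hM3⟩ := exists_norm_le_of_sqNorm hg.sqNorm_ne_top
  obtain ⟨M4, hM4⟩ := exists_norm_le_of_sqNorm
    (((hf (t + r)).sub (hf t)).const_mul (r : ℂ)⁻¹).sqNorm_ne_top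
  congr 2
  funext z
  rw [synth_sub hγ hM4 hM3, synth_const_mul, synth_sub hγ hM1 hM2]

lemma linEqAt_iff_fourierEqAt {γ : ℝ} (hγ : 0 < γ) {v : ℝ → ℂ → ℂ} {c : ℝ → ℤ → ℂ}
    {f : ℝ → ℝ → ℂ} (hv : ∀ t, v t = synth γ (c t)) (hf : ∀ t, HasDFT (f t) (c t)) (t : ℝ) :
    LinEqAt γ v t ↔ FourierEqAt γ f t := by
  have h := hasDFT_fourierRHS hγ (hf t)
  rw [linEqAt_iff hγ (fun t => (hf t).sqNorm_ne_top) hv,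
    fourierEqAt_iff (fun t => (hf t).1) (fun t => (hf t).2.1) h.1 h.2.1,
    ← hasL2Deriv_strip_iff hγ hf h, funext hv]

/-! ### An exponentially growing solution -/

open scoped BoundedContinuousFunction in
/-- The evolution `∂ₜf = -i(a f + b conj f)` on bounded continuous functions of `ξ`, solved by the
exponential of a bounded real-linear operator. -/
lemma exists_flow {a b : ℝ → ℝ} (ha : Continuous a) (hb : Continuous b) {A B : ℝ}
    (hA : ∀ ξ, |a ξ| ≤ A) (hB : ∀ ξ, |b ξ| ≤ B) :
    ∃ F G : ℝ → ℝ →ᵇ ℂ, (∀ ξ, F 0 ξ = 1) ∧ (∀ t, HasDerivAt F (G t) t) ∧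
      ∀ t ξ, G t ξ = -Complex.I * (a ξ * F t ξ + b ξ * conj (F t ξ)) := by
  set fa : ℝ →ᵇ ℂ := BoundedContinuousFunction.ofNormedAddCommGroup
    (fun ξ => -Complex.I * (a ξ : ℂ)) (by fun_prop) A (fun ξ => by simpa using hA ξ) with hfa
  set fb : ℝ →ᵇ ℂ := BoundedContinuousFunction.ofNormedAddCommGroup
    (fun ξ => -Complex.I * (b ξ : ℂ)) (by fun_prop) B (fun ξ => by simpa using hB ξ) with hfb
  set T : (ℝ →ᵇ ℂ) →L[ℝ] (ℝ →ᵇ ℂ) := ContinuousLinearMap.mul ℝ (ℝ →ᵇ ℂ) fa +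
    (ContinuousLinearMap.mul ℝ (ℝ →ᵇ ℂ) fb).comp
      (starL' ℝ : (ℝ →ᵇ ℂ) ≃L[ℝ] (ℝ →ᵇ ℂ)).toContinuousLinearMap with hT
  refine ⟨fun t => NormedSpace.exp (t • T) 1, fun t => T (NormedSpace.exp (t • T) 1), ?_, ?_, ?_⟩
  · intro ξ
    have h : (0 : ℝ) • T = 0 := zero_smul ℝ T
    simp only [h, NormedSpace.exp_zero]
    simp
  · intro t
    have h := hasDerivAt_exp_smul_const' T t
    exact (((ContinuousLinearMap.apply ℝ (ℝ →ᵇ ℂ)) (1 : ℝ →ᵇ ℂ)).hasFDerivAt.comp_hasDerivAt t h)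
  · intro t ξ
    set f := NormedSpace.exp (t • T) 1
    simp [hT, hfa, hfb]
    ring

/-- The real-linear system `z' = -i(a z + b conj z)` with `b - a, b + a > 0` is hyperbolic: the
combination `√(b+a) Re z - √(b-a) Im z` grows at the rate `√((b-a)(b+a))`. -/
lemma exp_growth {a b : ℝ} {z : ℝ → ℂ} (h1 : 0 < b - a) (h2 : 0 < b + a) (h0 : z 0 = 1)
    (hz : ∀ t, HasDerivAt z (-Complex.I * (a * z t + b * conj (z t))) t) (t : ℝ) :
    Real.sqrt (b + a) * Real.exp (Real.sqrt ((b - a) * (b + a)) * t) ≤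
      (Real.sqrt (b + a) + Real.sqrt (b - a)) * ‖z t‖ := by
  set r := Real.sqrt (b + a) with hr
  set s := Real.sqrt (b - a) with hs
  have hr2 : r ^ 2 = b + a := Real.sq_sqrt h2.le
  have hs2 : s ^ 2 = b - a := Real.sq_sqrt h1.le
  have hr0 : 0 ≤ r := Real.sqrt_nonneg _
  have hs0 : 0 ≤ s := Real.sqrt_nonneg _
  have hm : Real.sqrt ((b - a) * (b + a)) = s * r := Real.sqrt_mul h1.le _
  rw [hm]
  have hp : ∀ t, HasDerivAt (fun t => (z t).re) (-(b - a) * (z t).im) t := fun t => by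
    refine (Complex.reCLM.hasFDerivAt.comp_hasDerivAt t (hz t)).congr_deriv ?_
    simp
    ring
  have hq : ∀ t, HasDerivAt (fun t => (z t).im) (-(b + a) * (z t).re) t := fun t => by
    refine (Complex.imCLM.hasFDerivAt.comp_hasDerivAt t (hz t)).congr_deriv ?_
    simp
    ring
  set Y : ℝ → ℝ := fun t => (r * (z t).re - s * (z t).im) * Real.exp (-(s * r) * t) with hY
  have hYd : ∀ t, HasDerivAt Y 0 t := fun t => by
    have h3 := ((hp t).const_mul r).sub ((hq t).const_mul s)
    have h4 : HasDerivAt (fun t => Real.exp (-(s * r) * t))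
        (Real.exp (-(s * r) * t) * (-(s * r))) t := by
      have := (hasDerivAt_id t).const_mul (-(s * r))
      simpa using this.exp
    refine (h3.mul h4).congr_deriv ?_
    simp only [Pi.sub_apply]
    rw [← hr2, ← hs2]
    ring
  have hconst : Y t = Y 0 :=
    is_const_of_deriv_eq_zero (fun t => (hYd t).differentiableAt) (fun t => (hYd t).deriv) t 0
  simp only [hY, h0, Complex.one_re, Complex.one_im, mul_zero, mul_one, sub_zero, Real.exp_zero]
    at hconst
  have h5 : r * Real.exp (s * r * t) = r * (z t).re - s * (z t).im := by
    have h6 : Real.exp (-(s * r) * t) * Real.exp (s * r * t) = 1 := by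
      rw [← Real.exp_add]
      simp
    linear_combination (r * (z t).re - s * (z t).im) * h6 - Real.exp (s * r * t) * hconst
  rw [h5]
  have h6 := abs_le.1 (Complex.abs_re_le_norm (z t))
  have h7 := abs_le.1 (Complex.abs_im_le_norm (z t))
  nlinarith [h6.2, h7.1]

lemma system_solution_unique {a b : ℝ} {z w : ℝ → ℂ} (h0 : z 0 = w 0)
    (hz : ∀ t, HasDerivAt z (-Complex.I * (a * z t + b * conj (z t))) t)
    (hw : ∀ t, HasDerivAt w (-Complex.I * (a * w t + b * conj (w t))) t) : z = w := by
  refine ODE_solution_unique_univ (K := (|a| + |b|).toNNReal) (s := fun _ => univ)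
    (v := fun _ u => -Complex.I * (a * u + b * conj u)) (t₀ := 0) (fun t => ?_)
    (fun t => ⟨hz t, mem_univ _⟩) (fun t => ⟨hw t, mem_univ _⟩) h0
  refine LipschitzWith.lipschitzOnWith (LipschitzWith.of_dist_le_mul fun x y => ?_)
  rw [dist_eq_norm, dist_eq_norm, Real.coe_toNNReal _ (by positivity)]
  have e : -Complex.I * (a * x + b * conj x) - -Complex.I * (a * y + b * conj y) =
      -Complex.I * (a * (x - y) + b * conj (x - y)) := by rw [map_sub]; ring
  rw [e, norm_mul, norm_neg, Complex.norm_I, one_mul]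
  refine (norm_add_le _ _).trans ?_
  rw [norm_mul, norm_mul, RCLike.norm_conj, Complex.norm_real, Complex.norm_real, add_mul]
  rfl

lemma continuous_aSym {γ : ℝ} (hγ : 0 < γ) : Continuous (aSym γ) := by
  have := continuous_ell hγ
  unfold aSym
  fun_prop

lemma continuous_bSym {γ : ℝ} (hγ : 0 < γ) : Continuous (bSym γ) := by
  have := continuous_ell hγ
  unfold bSym
  fun_prop

lemma bSym_le {γ : ℝ} (hγ : 0 < γ) (ξ : ℝ) : bSym γ ξ ≤ CM γ * ell γ 0 ^ 2 := by
  have := CM_pos γ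
  have h1 := ell_pos hγ ξ
  have h2 := ell_le hγ ξ
  unfold bSym
  gcongr

lemma abs_aSym_le {γ : ℝ} (hγ : 0 < γ) (ξ : ℝ) : |aSym γ ξ| ≤ CM γ * ell γ 0 ^ 2 := by
  have hC := CM_pos γ
  have h0 := ell_zero_pos hγ
  have h1 := ell_pos hγ ξ
  have h2 := ell_le hγ ξ
  rw [aSym, abs_mul, abs_of_pos hC]
  refine mul_le_mul_of_nonneg_left ?_ hC.le
  rw [abs_le]
  constructor <;> nlinarith

/-- A solution of the linearized equation in Fourier variables with initial datum `1`. -/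
lemma exists_fourier_solution {γ : ℝ} (hγ : 0 < γ) : ∃ f : ℝ → ℝ → ℂ,
    (∀ ξ, f 0 ξ = 1) ∧ (∀ t, Function.Periodic (f t) 1) ∧ (∀ t, MemLp (f t) 2 unitMeasure) ∧
    (∀ t, FourierEqAt γ f t) ∧
    ∀ ξ t, HasDerivAt (fun s => f s ξ) (-Complex.I * (aSym γ ξ * f t ξ +
      bSym γ ξ * conj (f t ξ))) t := by
  obtain ⟨F, G, h0, hF, hG⟩ := exists_flow (continuous_aSym hγ) (continuous_bSym hγ)
    (abs_aSym_le hγ) (fun ξ => by rw [abs_of_pos (bSym_pos hγ ξ)]; exact bSym_le hγ ξ)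
  have hpt : ∀ ξ t, HasDerivAt (fun s => F s ξ) (-Complex.I * (aSym γ ξ * F t ξ +
      bSym γ ξ * conj (F t ξ))) t := fun ξ t => by
    rw [← hG]
    exact (BoundedContinuousFunction.evalCLM ℝ ξ).hasFDerivAt.comp_hasDerivAt t (hF t)
  -- The solution at `ξ` depends only on `ℓ(ξ)`; hence it is 1-periodic and even in `ξ`.
  have huniq : ∀ ξ η, ell γ η = ell γ ξ → ∀ t, F t η = F t ξ := by
    intro ξ η h t
    have hz := hpt η
    have ea : aSym γ η = aSym γ ξ := by simp only [aSym, h]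
    have eb : bSym γ η = bSym γ ξ := by simp only [bSym, h]
    rw [ea, eb] at hz
    exact congrFun (system_solution_unique (by simp only [h0]) hz (hpt ξ)) t
  have hper : ∀ t, Function.Periodic (F t) 1 := fun t ξ => huniq _ _ (ell_add_one γ ξ) t
  have hGR : ∀ t, fourierRHS γ (F t) = G t := fun t => by
    funext ξ
    rw [hG, fourierRHS, huniq ξ (-ξ) (ell_neg γ ξ)]
  refine ⟨fun t => F t, h0, hper, fun t => memLp_of_continuous (F t).continuous, fun t => ?_, hpt⟩
  have hGper : Function.Periodic (G t) 1 := fun ξ => by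
    simp only [hG, hper t ξ, aSym, bSym, ell_add_one]
  rw [fourierEqAt_iff hper (fun t => memLp_of_continuous (F t).continuous)
    (by rw [hGR]; exact hGper) (by rw [hGR]; exact memLp_of_continuous (G t).continuous), hGR]
  have h1 := hasDerivAt_iff_tendsto_slope_zero.1 (hF t)
  have h2 := (tendsto_iff_norm_sub_tendsto_zero.1 h1)
  have h3 : Tendsto (fun h : ℝ => ENNReal.ofReal ‖h⁻¹ • (F (t + h) - F t) - G t‖) (𝓝[≠] 0)
      (𝓝 0) := by
    simpa using ENNReal.tendsto_ofReal h2
  refine tendsto_of_tendsto_of_tendsto_of_le_of_le tendsto_const_nhds h3 (fun _ => zero_le)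
    fun h => ?_
  refine (eLpNorm_le_of_ae_bound (C := ‖h⁻¹ • (F (t + h) - F t) - G t‖)
    (Eventually.of_forall fun ξ => ?_)).trans ?_
  · have := (h⁻¹ • (F (t + h) - F t) - G t).norm_coe_le_norm ξ
    simpa using this
  · simp [unitMeasure]

/-- Uniform growth on an interval close to `0`, where both `b ± a` are bounded below. -/
lemma exists_growth {γ : ℝ} (hγ : 0 < γ) {f : ℝ → ℝ → ℂ} (h0 : ∀ ξ, f 0 ξ = 1)
    (hf : ∀ ξ t, HasDerivAt (fun s => f s ξ) (-Complex.I * (aSym γ ξ * f t ξ +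
      bSym γ ξ * conj (f t ξ))) t) :
    ∃ σ > 0, ∃ C > 0, ∀ t : ℝ, 0 ≤ t →
      ENNReal.ofReal (C * Real.exp (σ * t)) ≤ eLpNorm (f t) 2 unitMeasure := by
  obtain ⟨δ₀, hδ₀, hpos₀⟩ := exists_bSym_gt_abs_aSym hγ
  set δ := min δ₀ 1 with hδ
  have hδpos : 0 < δ := by positivity
  set I := Icc (δ / 4) (δ / 2) with hI
  have hne : I.Nonempty := ⟨δ / 4, le_refl _, by linarith⟩
  have hpos : ∀ ξ ∈ I, 0 < bSym γ ξ - aSym γ ξ ∧ 0 < bSym γ ξ + aSym γ ξ := by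
    intro ξ hξ
    have h1 : 0 < ξ := by linarith [hξ.1]
    have h2 : ξ < δ₀ := by linarith [hξ.2, min_le_left δ₀ 1]
    exact hpos₀ ξ (abs_pos.2 h1.ne') (by rwa [abs_of_pos h1])
  obtain ⟨x, hx, hxmin⟩ := isCompact_Icc.exists_isMinOn hne
    ((continuous_bSym hγ).sub (continuous_aSym hγ)).continuousOn
  obtain ⟨y, hy, hymin⟩ := isCompact_Icc.exists_isMinOn hne
    ((continuous_bSym hγ).add (continuous_aSym hγ)).continuousOn
  set ε := min (bSym γ x - aSym γ x) (bSym γ y + aSym γ y) with hε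
  have hεpos : 0 < ε := lt_min (hpos x hx).1 (hpos y hy).2
  set M := 2 * (CM γ * ell γ 0 ^ 2) with hM
  have hM0 : 0 < M := by
    have := CM_pos γ
    have := ell_zero_pos hγ
    positivity
  set c₀ := Real.sqrt ε / (2 * Real.sqrt M) with hc₀
  have hc₀pos : 0 < c₀ := by positivity
  have hpt : ∀ ξ ∈ I, ∀ t : ℝ, 0 ≤ t → c₀ * Real.exp (ε * t) ≤ ‖f t ξ‖ := by
    intro ξ hξ t ht
    obtain ⟨h1, h2⟩ := hpos ξ hξ
    have e1 : ε ≤ bSym γ ξ - aSym γ ξ := (min_le_left _ _).trans (hxmin hξ)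
    have e2 : ε ≤ bSym γ ξ + aSym γ ξ := (min_le_right _ _).trans (hymin hξ)
    have hb := bSym_le hγ ξ
    have h3 := exp_growth h1 h2 (h0 ξ) (hf ξ) t
    have h4 : Real.sqrt ε ≤ Real.sqrt (bSym γ ξ + aSym γ ξ) := Real.sqrt_le_sqrt e2
    have h5 : Real.sqrt (bSym γ ξ + aSym γ ξ) ≤ Real.sqrt M := Real.sqrt_le_sqrt (by linarith)
    have h6 : Real.sqrt (bSym γ ξ - aSym γ ξ) ≤ Real.sqrt M := Real.sqrt_le_sqrt (by linarith)
    have h7 : ε ≤ Real.sqrt ((bSym γ ξ - aSym γ ξ) * (bSym γ ξ + aSym γ ξ)) :=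
      Real.le_sqrt_of_sq_le (by nlinarith)
    have h8 : Real.sqrt ε * Real.exp (ε * t) ≤ (2 * Real.sqrt M) * ‖f t ξ‖ := by
      calc Real.sqrt ε * Real.exp (ε * t) ≤ Real.sqrt (bSym γ ξ + aSym γ ξ) * Real.exp
            (Real.sqrt ((bSym γ ξ - aSym γ ξ) * (bSym γ ξ + aSym γ ξ)) * t) := by gcongr
        _ ≤ _ := h3
        _ ≤ _ := by gcongr; linarith
    rw [hc₀, div_mul_eq_mul_div, div_le_iff₀ (by positivity)]
    linarith
  refine ⟨ε, hεpos, c₀ * (δ / 4) ^ (1 / 2 : ℝ), by positivity, fun t ht => ?_⟩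
  have hsub : I ⊆ Icc (0 : ℝ) 1 := Icc_subset_Icc (by linarith)
    (by linarith [min_le_right δ₀ 1])
  calc ENNReal.ofReal (c₀ * (δ / 4) ^ (1 / 2 : ℝ) * Real.exp (ε * t))
      = eLpNorm (fun _ : ℝ => c₀ * Real.exp (ε * t)) 2 (volume.restrict I) := by
        rw [eLpNorm_const' _ (by norm_num) (by norm_num), Measure.restrict_apply_univ, hI,
          Real.volume_Icc, show δ / 2 - δ / 4 = δ / 4 by ring, Real.enorm_of_nonneg (by positivity),
          ENNReal.toReal_ofNat, ENNReal.ofReal_rpow_of_pos (by positivity),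
          ← ENNReal.ofReal_mul (by positivity)]
        congr 1
        ring
    _ ≤ eLpNorm (f t) 2 (volume.restrict I) := by
        refine eLpNorm_mono_ae ((ae_restrict_iff' measurableSet_Icc).2
          (Eventually.of_forall fun ξ hξ => ?_))
        rw [Real.norm_of_nonneg (by positivity)]
        exact hpt ξ hξ t ht
    _ ≤ eLpNorm (f t) 2 unitMeasure := eLpNorm_mono_measure _ (Measure.restrict_mono hsub le_rfl)

lemma exists_unstable_solution {γ : ℝ} (hγ : 0 < γ) :
    ∃ σ > 0, ∃ C > 0, ∃ v : ℝ → ℂ → ℂ, IsLinSolution γ v ∧ v 0 = psi γ 0 ∧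
      ∀ t : ℝ, 0 ≤ t → ENNReal.ofReal (C * Real.exp (σ * t)) ≤
        eLpNorm (v t) 2 (stripMeasure γ) := by
  obtain ⟨f, h0, hper, hmem, heq, hder⟩ := exists_fourier_solution hγ
  obtain ⟨σ, hσ, C, hC, hgrow⟩ := exists_growth hγ h0 hder
  have hdft : ∀ t, HasDFT (f t) (fcoef (f t)) := fun t => hasDFT_iff.2 ⟨hper t, hmem t, rfl⟩
  refine ⟨σ, hσ, C, hC, fun t => synth γ (fcoef (f t)), ⟨fun t => ?_, fun t => ?_⟩, ?_,
    fun t ht => ?_⟩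
  · exact InX_synth hγ (hdft t).sqNorm_ne_top
  · exact (linEqAt_iff_fourierEqAt hγ (fun _ => rfl) hdft t).2 (heq t)
  · have e : f 0 = fmode 0 := by
      funext ξ
      simp [h0, fmode]
    funext z
    simp only [e, synth, fcoef_fmode]
    rw [tsum_eq_single 0 fun n hn => by simp [hn]]
    simp
  · obtain ⟨M, hM⟩ := exists_norm_le_of_sqNorm (hdft t).sqNorm_ne_top
    have h1 := (eLpNorm_sq_synth hγ hM).trans (hdft t).eLpNorm_sq.symm
    have h2 := (ENNReal.pow_right_strictMono two_ne_zero).injective h1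
    dsimp only
    rw [h2]
    exact hgrow t ht

end LLL

end

theorem theorem4p1 (γ : ℝ) (hγ : 0 < γ) :
    -- `exp(-iλt) Φ₀` is a stationary wave
    (∀ z, LLL.bargmannProj (fun w => ((‖LLL.Phi0 γ w‖ ^ 2 : ℝ) : ℂ) * LLL.Phi0 γ w) z
      = (LLL.lam γ : ℂ) * LLL.Phi0 γ z) ∧
    -- expansion in the basis `ψ_n` and discrete Fourier transform
    (∀ u : ℂ → ℂ, LLL.InX γ u →
      ∃! c : ℤ → ℂ, LLL.HasPsiExpansion γ u c ∧ ∃ f : ℝ → ℂ, LLL.HasDFT f c) ∧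
    -- the linearized equation in the Fourier variable
    (∀ (v : ℝ → ℂ → ℂ) (c : ℝ → ℤ → ℂ) (f : ℝ → ℝ → ℂ),
      (∀ t, LLL.InX γ (v t)) →
      (∀ t, LLL.HasPsiExpansion γ (v t) (c t)) →
      (∀ t, LLL.HasDFT (f t) (c t)) →
      ∀ t, LLL.LinEqAt γ v t ↔ LLL.FourierEqAt γ f t) ∧
    -- the eigenvalues are `±μ(ξ)`
    (∀ ξ : ℝ, (LLL.Arect γ ξ).charpoly =
      (Polynomial.X - Polynomial.C (LLL.mu γ ξ)) *
        (Polynomial.X - Polynomial.C (-LLL.mu γ ξ))) ∧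
    -- diagonalization
    (∀ ξ : ℝ, LLL.mu γ ξ ≠ 0 →
      IsUnit (LLL.Pmat γ ξ).det ∧
      LLL.Arect γ ξ = LLL.Pmat γ ξ *
        Matrix.diagonal ![LLL.mu γ ξ, -LLL.mu γ ξ] * (LLL.Pmat γ ξ)⁻¹) ∧
    (∀ ξ : ℝ, LLL.mu γ ξ = 0 ↔
      (∃ k : ℤ, ξ = k) ∨ LLL.ell γ ξ = (Real.sqrt 2 - 1) * LLL.ell γ 0) ∧
    {ξ ∈ Set.Icc (0 : ℝ) 1 | LLL.mu γ ξ = 0}.Finite ∧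
    -- purely imaginary nonzero eigenvalues near `0`
    (∃ δ > 0, ∀ ξ : ℝ, 0 < |ξ| → |ξ| < δ →
      (LLL.mu γ ξ).re = 0 ∧ LLL.mu γ ξ ≠ 0) ∧
    -- square lattice
    (LLL.tau γ = Complex.I → ∀ ξ : ℝ, (¬ ∃ k : ℤ, ξ = k) →
      (LLL.mu γ ξ).re = 0 ∧ LLL.mu γ ξ ≠ 0) ∧
    -- exponential instability in `L²(S_γ) ∩ F_γ`
    (∃ σ > 0, ∃ C > 0, ∃ v : ℝ → ℂ → ℂ,
      LLL.IsLinSolution γ v ∧ v 0 = LLL.psi γ 0 ∧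
      ∀ t : ℝ, 0 ≤ t →
        ENNReal.ofReal (C * Real.exp (σ * t)) ≤ MeasureTheory.eLpNorm (v t) 2
          (LLL.stripMeasure γ)) := by
  refine ⟨LLL.stationary_wave hγ, fun u hu => LLL.existsUnique_expansion hγ hu,
    fun v c f hv hc hf t => ?_, LLL.charpoly_Arect γ, fun ξ h => LLL.Arect_diagonalization hγ h,
    LLL.mu_eq_zero_iff hγ, LLL.finite_mu_eq_zero hγ, ?_,
    fun hτ ξ hξ => LLL.mu_re_eq_zero_of_pos (LLL.Dsym_pos_of_square hγ hτ hξ),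
    LLL.exists_unstable_solution hγ⟩
  · exact LLL.linEqAt_iff_fourierEqAt hγ
      (fun t => (LLL.eq_synth_of_hasPsiExpansion hγ (hv t) (hc t)).2) hf t
  · obtain ⟨δ, hδ, h⟩ := LLL.exists_bSym_gt_abs_aSym hγ
    refine ⟨δ, hδ, fun ξ h1 h2 => LLL.mu_re_eq_zero_of_pos ?_⟩
    rw [LLL.Dsym_eq]
    exact mul_pos (h ξ h1 h2).1 (h ξ h1 h2).2
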